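/- All graphs are finite and simple. A cactus is a connected graph in which any two distinct cycles have at most one common vertex. For a connected graph $G$ with distance function $d$, put $d(xy,w)=\min\{d(x,w),d(y,w)\}$ for an edge $xy$ and a vertex $w$. For an edge $uv$ of $G$ let $n_u(uv)$ be the number of vertices $w$ with $d(u,w)<d(v,w)$, and let $m_u(uv)$ be the number of edges $f$ with $d(f,u)<d(f,v)$; define $n_v(uv)$ and $m_v(uv)$ symmetrically. The edge Szeged index and the edge-vertex Szeged index of $G$ are $$Sz_e(G)=\sum_{uv\in E(G)} m_u(uv)\,m_v(uv),\qquad Sz_{ev}(G)=\frac12\sum_{uv\in E(G)}\bigl[n_u(uv)\,m_v(uv)+n_v(uv)\,m_u(uv)\bigr].$$ Let $C_0(n,1)$ be the graph on $n$ vertices that consists of a triangle with $n-3$ pendant edges attached at one of its vertices. For every cactus $G$ with $n\ge 5$ vertices and $k\ge 1$ cycles, $$Sz_e(G)\ \ge\ 2n-3,\qquad Sz_{ev}(G)\ \ge\ \frac12\,(n^2-3).$$ Moreover, in each of the two inequalities equality holds if and only if $G\cong C_0(n,1)$. -/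

import Mathlib

namespace SimpleGraph

/-- The cycles of `G`, as subgraphs: closed walks that differ only in their starting point or
direction give the same cycle. -/
def cycles {V : Type*} (G : SimpleGraph V) : Set G.Subgraph :=
  {H | ∃ (v : V) (w : G.Walk v v), w.IsCycle ∧ w.toSubgraph = H}

/-- A cactus: a connected graph in which any two distinct cycles have at most one common
vertex. -/
def IsCactus {V : Type*} (G : SimpleGraph V) : Prop :=
  G.Connected ∧
    ∀ C ∈ G.cycles, ∀ D ∈ G.cycles, C ≠ D → (C.verts ∩ D.verts).Subsingleton

/-- The distance between an edge `xy` and a vertex `w`: `min (d(x, w)) (d(y, w))`. -/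
noncomputable def edgeVertexDist {V : Type*} (G : SimpleGraph V) (e : Sym2 V) (w : V) : ℕ :=
  Sym2.lift ⟨fun x y => min (G.dist x w) (G.dist y w), fun _ _ => min_comm _ _⟩ e

/-- `n_u(uv|G)`: the number of vertices closer to `u` than to `v`. -/
noncomputable def vertexCount {V : Type*} [Fintype V] (G : SimpleGraph V) (u v : V) : ℕ :=
  (Finset.univ.filter fun w : V => G.dist u w < G.dist v w).card

/-- `m_u(uv|G)`: the number of edges closer to `u` than to `v`. -/
noncomputable def edgeCount {V : Type*} (G : SimpleGraph V) [Fintype G.edgeSet] (u v : V) : ℕ :=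
  (G.edgeFinset.filter fun f => G.edgeVertexDist f u < G.edgeVertexDist f v).card

/-- The edge Szeged index, `∑ m_u(uv|G) m_v(uv|G)` over the edges `uv`. -/
noncomputable def edgeSzeged {V : Type*} (G : SimpleGraph V) [Fintype G.edgeSet] : ℕ :=
  ∑ e ∈ G.edgeFinset,
    Sym2.lift ⟨fun u v => G.edgeCount u v * G.edgeCount v u, fun _ _ => mul_comm _ _⟩ e

/-- The edge-vertex Szeged index,
`(1/2) ∑ [n_u(uv|G) m_v(uv|G) + n_v(uv|G) m_u(uv|G)]` over the edges `uv`. -/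
noncomputable def edgeVertexSzeged {V : Type*} [Fintype V] (G : SimpleGraph V)
    [Fintype G.edgeSet] : ℚ :=
  (1 / 2 : ℚ) * ∑ e ∈ G.edgeFinset,
    Sym2.lift ⟨fun u v => ((G.vertexCount u v : ℚ) * (G.edgeCount v u : ℚ)
      + (G.vertexCount v u : ℚ) * (G.edgeCount u v : ℚ)), fun _ _ => add_comm _ _⟩ e

/-- `C₀(n, k)`, for `2 * k + 1 ≤ n`: the vertex `0` is joined to all other vertices, and the
vertices `2 * i + 1` and `2 * i + 2` are joined for `i < k`. So `k` triangles share the vertex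
`0`, and the remaining `n - 2 * k - 1` vertices are pendant vertices attached at `0`. -/
def triangleBundle (n k : ℕ) : SimpleGraph (Fin n) :=
  SimpleGraph.fromRel fun a b =>
    a.val = 0 ∨ ∃ i < k, a.val = 2 * i + 1 ∧ b.val = 2 * i + 2

end SimpleGraph

/-! Write `N` and `m` for the numbers of vertices and edges; since `G` is connected and has a cycle,
`m ≥ N`. Fix one cycle, of length `L`. In a cactus, deleting its edges puts its vertices into
distinct components, so every vertex `x` has a unique gate `γ x` on the cycle, and every path from
`x` to another cycle vertex runs through that gate. Let `aᵢ` be the number of edges in the component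
(fiber) of the `i`-th cycle vertex; then `m = L + ∑ aᵢ`.

Edge Szeged index: the edges of this one cycle suffice. For `L = 3` the cycle edge `i` contributes
at least `(1 + aᵢ)(1 + aᵢ₊₁)`, which sums to at least `2m - 3`. For `L = 4` two fibers lie on each
side and the sum is at least `4m - 12`; for `L ≥ 5` two cycle edges lie on each side and the sum is
at least `4m`. The last two exceed `2N - 3`.

Edge-vertex index: compare `n_u m_v + n_v m_u` with `n_u + n_v`. The latter sums to at least `N(N -
1)`, because for each `w` at least `N - 1` edges have endpoints at different distances from `w`. The
comparison can fail only at pendant edges, by at most one per leaf, and there are at most `N - L`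
leaves. The cycle edges give a surplus, at least `2(m - 3)` for `L = 3`, so the total is at least
`N(N - 1) - (N - 3) + 2(N - 3) = N² - 3`. For `L ≥ 4` the surplus makes the inequality strict.

Equality therefore forces `L = 3` and no slack: no two fibers both have edges, and every edge off
the triangle has a leaf. This is a triangle with pendant edges at one vertex (`IsTriangleStar`), for
which direct upper bounds match the lower ones. -/

namespace SimpleGraph

/-! ### Retraction of a cactus onto one of its cycles -/

variable {V : Type*} {G : SimpleGraph V}

/-- A retraction of `G` onto a cycle of length `L`: an indexing `c` of the vertices of a cycle and a
map `γ` sending each vertex to the index of the cycle vertex through which it is attached. -/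
structure CycleRetraction (G : SimpleGraph V) (L : ℕ) where
  /-- the vertices of the cycle -/
  c : ZMod L → V
  /-- the index of the gate of a vertex -/
  γ : V → ZMod L
  γ_c : ∀ i, γ (c i) = i
  adj_succ : ∀ i, G.Adj (c i) (c (i + 1))
  eq_or_eq_of_adj : ∀ {x y}, G.Adj x y → γ x = γ y ∨ ∃ i, s(x, y) = s(c i, c (i + 1))

/-- In a cactus, distinct vertices of a cycle are not connected off the edges of that cycle. -/
theorem IsCactus.not_reachable_deleteEdges (hG : G.IsCactus) {v : V} {w : G.Walk v v}
    (hw : w.IsCycle) {a b : V} (ha : a ∈ w.support) (hb : b ∈ w.support) (hab : a ≠ b) :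
    ¬ (G.deleteEdges w.edgeSet).Reachable a b := by
  classical
  set H := G.deleteEdges w.edgeSet with hH
  rintro ⟨p₀⟩
  -- The length is minimized over all pairs of cycle vertices, not just the given one; this keeps
  -- the interior of the path off the cycle.
  have hex : ∃ n : ℕ, ∃ a b : V, a ∈ w.support ∧ b ∈ w.support ∧ a ≠ b ∧
      ∃ p : H.Walk a b, p.length = n := ⟨_, a, b, ha, hb, hab, p₀, rfl⟩
  have hmin := fun m => Nat.find_min hex (m := m)
  obtain ⟨a, b, ha, hb, hab, p₁, hp₁⟩ := Nat.find_spec hex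
  have hp := p₁.bypass_isPath
  have hpl : p₁.bypass.length ≤ Nat.find hex := hp₁ ▸ p₁.length_bypass_le_length
  generalize p₁.bypass = p at hp hpl
  have hint : ∀ x ∈ p.support, x ∈ w.support → x = a ∨ x = b := by
    intro x hx hxw
    by_contra! hne
    have hlt := Walk.length_takeUntil_lt_length hx hne.2
    exact hmin _ (lt_of_lt_of_le hlt hpl) ⟨a, x, ha, hxw, hne.1.symm, p.takeUntil x hx, rfl⟩
  have hle : H ≤ G := deleteEdges_le _
  have hpe : ∀ e ∈ p.edges, e ∉ w.edges := by
    intro e he hew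
    have := p.edges_subset_edgeSet he
    rw [hH, edgeSet_deleteEdges] at this
    exact this.2 hew
  have hwa := hw.rotate ha
  have hb' : b ∈ (w.rotate a ha).support := by
    rw [Walk.mem_support_rotate_iff]; exact hb
  set q := (w.rotate a ha).takeUntil b hb' with hq
  have hqp : q.IsPath := hwa.isPath_takeUntil hb'
  have hqe : ∀ e ∈ q.edges, e ∈ w.edges := fun e he =>
    (w.rotate_edges a ha).mem_iff.1 (Walk.edges_takeUntil_subset_edges _ hb' he)
  have hqs : ∀ x ∈ q.support, x ∈ w.support := fun x hx =>
    (Walk.mem_support_rotate_iff ..).1 (Walk.support_takeUntil_subset_support _ hb' hx)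
  have hnil : ¬ p.Nil := Walk.not_nil_of_ne hab
  set r : G.Walk a a := (p.mapLe hle).append q.reverse with hr
  have hrc : r.IsCycle := by
    rw [Walk.isCycle_def, hr, Walk.isTrail_append]
    refine ⟨⟨?_, ?_, ?_⟩, ?_, ?_⟩
    · exact (hp.mapLe hle).isTrail
    · exact hqp.reverse.isTrail
    · intro e he he'
      rw [Walk.edges_mapLe_eq_edges] at he
      rw [Walk.edges_reverse, List.mem_reverse] at he'
      exact hpe e he (hqe e he')
    · intro h0
      have := congrArg Walk.length h0
      simp only [Walk.length_append, Walk.length_nil] at this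
      have h1 : (p.mapLe hle).length = 0 := by omega
      rw [Walk.length_mapLe] at h1
      exact hab (Walk.eq_of_length_eq_zero h1)
    · rw [Walk.tail_support_append, List.nodup_append']
      refine ⟨(hp.mapLe hle).support_nodup.tail, hqp.reverse.support_nodup.tail, ?_⟩
      intro x hx hx'
      have hxp : x ∈ p.support := by
        rw [← Walk.support_mapLe_eq_support hle]; exact List.mem_of_mem_tail hx
      have hxq : x ∈ q.support := by
        have := List.mem_of_mem_tail hx'
        rwa [Walk.support_reverse, List.mem_reverse] at this
      rcases hint x hxp (hqs x hxq) with rfl | rfl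
      · have := (hp.mapLe hle).support_nodup
        rw [← Walk.cons_tail_support, List.nodup_cons] at this
        exact this.1 hx
      · have := hqp.reverse.support_nodup
        rw [← Walk.cons_tail_support, List.nodup_cons] at this
        exact this.1 hx'
  have hne : r.toSubgraph ≠ w.toSubgraph := by
    intro h
    obtain ⟨e, he⟩ : ∃ e, e ∈ p.edges :=
      List.exists_mem_of_ne_nil _ (fun h => hnil (Walk.edges_eq_nil.1 h))
    have h1 : e ∈ r.toSubgraph.edgeSet := by
      rw [Walk.mem_edges_toSubgraph, hr, Walk.edges_append, Walk.edges_mapLe_eq_edges]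
      exact List.mem_append_left _ he
    rw [h, Walk.mem_edges_toSubgraph] at h1
    exact hpe e he h1
  have hsub := hG.2 _ ⟨a, r, hrc, rfl⟩ _ ⟨v, w, hw, rfl⟩ hne
  refine hab (hsub ⟨?_, ?_⟩ ⟨?_, ?_⟩)
  · exact r.start_mem_verts_toSubgraph
  · exact w.mem_verts_toSubgraph.2 ha
  · rw [Walk.mem_verts_toSubgraph, hr, Walk.mem_support_append_iff]
    exact Or.inl (Walk.end_mem_support _)
  · exact w.mem_verts_toSubgraph.2 hb

/-- Every vertex is connected to some vertex of a closed walk off the edges of that walk. -/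
theorem Connected.exists_reachable_deleteEdges (hG : G.Connected) {v : V} (w : G.Walk v v) (x : V) :
    ∃ a ∈ w.support, (G.deleteEdges w.edgeSet).Reachable x a := by
  obtain ⟨p⟩ := hG x v
  induction p with
  | nil => exact ⟨_, w.start_mem_support, Reachable.rfl⟩
  | @cons x y z h p ih =>
    obtain ⟨a, ha, hya⟩ := ih w
    -- If the next edge of the walk belongs to the cycle, `x` already lies on the cycle and is its
    -- own witness.
    by_cases hxy : s(x, y) ∈ w.edges
    · exact ⟨x, w.fst_mem_support_of_mem_edges hxy, Reachable.rfl⟩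
    · refine ⟨a, ha, Reachable.trans (Adj.reachable ?_) hya⟩
      rw [deleteEdges_adj]
      exact ⟨h, hxy⟩

theorem IsCactus.exists_cycleRetraction (hG : G.IsCactus) (hne : G.cycles.Nonempty) :
    ∃ L, 3 ≤ L ∧ Nonempty (CycleRetraction G L) := by
  obtain ⟨_, v, w, hw, rfl⟩ := hne
  have hL := hw.three_le_length
  refine ⟨w.length, hL, ?_⟩
  set L := w.length with hLdef
  have : NeZero L := ⟨by omega⟩
  have : Fact (1 < L) := ⟨by omega⟩
  let c : ZMod L → V := fun i => w.getVert i.val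
  have hinj : Function.Injective c := by
    intro i j hij
    have hi := i.val_lt
    have hj := j.val_lt
    exact ZMod.val_injective L (hw.getVert_injOn' (by simp only [Set.mem_ofPred_eq]; omega)
      (by simp only [Set.mem_ofPred_eq]; omega) hij)
  have hmem : ∀ i, c i ∈ w.support := fun i => w.getVert_mem_support _
  -- The case `k = L` is included: the walk is closed, so position `L` agrees with position `0`.
  have hcast : ∀ k, k ≤ L → c (k : ZMod L) = w.getVert k := by
    intro k hk
    rcases hk.lt_or_eq with hk | rfl
    · simp only [c, ZMod.val_natCast_of_lt hk]
    · simp [c, hLdef]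
  have hsucc : ∀ k, k < L → w.getVert (k + 1) = c ((k : ZMod L) + 1) := by
    intro k hk
    rw [← hcast (k + 1) hk]; push_cast; rfl
  have hsurj : ∀ a ∈ w.support, ∃ i, c i = a := by
    intro a ha
    obtain ⟨k, rfl, hk⟩ := Walk.mem_support_iff_exists_getVert.1 ha
    exact ⟨k, hcast k hk⟩
  have hgate : ∀ x, ∃ i, (G.deleteEdges w.edgeSet).Reachable x (c i) := by
    intro x
    obtain ⟨a, ha, hxa⟩ := hG.1.exists_reachable_deleteEdges w x
    obtain ⟨i, rfl⟩ := hsurj a ha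
    exact ⟨i, hxa⟩
  choose γ hγ using hgate
  have huniq : ∀ i j, (G.deleteEdges w.edgeSet).Reachable (c i) (c j) → i = j := by
    intro i j h
    by_contra hij
    exact hG.not_reachable_deleteEdges hw (hmem i) (hmem j) (hinj.ne hij) h
  refine ⟨⟨c, γ, fun i => (huniq _ _ (hγ (c i))).symm, ?_, ?_⟩⟩
  · intro i
    have hi := i.val_lt
    have h := w.adj_getVert_succ hi
    rw [hsucc _ hi, ZMod.natCast_zmod_val] at h
    exact h
  · intro x y hxy
    by_cases he : s(x, y) ∈ w.edges
    · right
      obtain ⟨k, hk, hke⟩ := w.mk_mem_edges_iff_exists.1 he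
      refine ⟨k, ?_⟩
      rw [← hke, hsucc k hk, hcast k hk.le]
    · left
      have hadj : (G.deleteEdges w.edgeSet).Adj x y := by
        rw [deleteEdges_adj]; exact ⟨hxy, he⟩
      exact huniq _ _ ((hγ x).symm.trans (hadj.reachable.trans (hγ y)))

end SimpleGraph

/-! ### Terms of the two indices, leaves, and the double count -/

namespace SimpleGraph

variable {V : Type*} {G : SimpleGraph V}

@[simp]
theorem edgeVertexDist_mk (x y w : V) :
    G.edgeVertexDist s(x, y) w = min (G.dist x w) (G.dist y w) := rfl

theorem Connected.dist_le_add_one (hG : G.Connected) {x y : V} (h : G.Adj x y) (r : V) :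
    G.dist x r ≤ G.dist y r + 1 := by
  have h1 := hG.dist_triangle (u := x) (v := y) (w := r)
  rw [dist_eq_one_iff_adj.2 h] at h1
  omega

theorem Connected.exists_adj_dist_add_one (hG : G.Connected) {x r : V} (hx : x ≠ r) :
    ∃ y, G.Adj x y ∧ G.dist y r + 1 = G.dist x r := by
  obtain ⟨p, hp⟩ := hG.exists_walk_length_eq_dist x r
  cases p with
  | nil => exact absurd rfl hx
  | @cons _ y _ h p =>
    refine ⟨y, h, le_antisymm ?_ (hG.dist_le_add_one h r)⟩
    rw [← hp, Walk.length_cons]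
    have := dist_le p
    omega

/-- A leaf of a graph: a vertex with at most one neighbour. -/
def IsLeaf (G : SimpleGraph V) (x : V) : Prop := (G.neighborSet x).Subsingleton

theorem IsLeaf.dist_eq_add_one (hG : G.Connected) {u v : V} (hu : G.IsLeaf u) (huv : G.Adj u v)
    {x : V} (hx : x ≠ u) : G.dist x u = G.dist x v + 1 := by
  obtain ⟨y, hy, hyx⟩ := hG.exists_adj_dist_add_one hx.symm
  obtain rfl := hu hy huv
  rw [dist_comm, ← hyx, dist_comm]

theorem one_le_vertexCount [Fintype V] {u v : V} (huv : G.Adj u v) : 1 ≤ G.vertexCount u v := by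
  refine Finset.card_pos.2 ⟨u, ?_⟩
  simp [dist_comm (u := v), dist_eq_one_iff_adj.2 huv]

theorem vertexCount_add_le_card [Fintype V] (u v : V) :
    G.vertexCount u v + G.vertexCount v u ≤ Fintype.card V := by
  classical
  rw [vertexCount, vertexCount, ← Finset.card_union_of_disjoint]
  · exact Finset.card_le_univ _
  · rw [Finset.disjoint_filter]
    intro w _ h1 h2
    omega

theorem card_le_edgeCount [Fintype G.edgeSet] {u v : V} {s : Finset (Sym2 V)}
    (h : ∀ f ∈ s, f ∈ G.edgeSet ∧ G.edgeVertexDist f u < G.edgeVertexDist f v) :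
    s.card ≤ G.edgeCount u v := by
  refine Finset.card_le_card fun f hf => ?_
  rw [Finset.mem_filter, mem_edgeFinset]
  exact h f hf

theorem Connected.edgeVertexDist_lt (hG : G.Connected) {u v y : V} (huv : u ≠ v) (hyv : y ≠ v) :
    G.edgeVertexDist s(u, y) u < G.edgeVertexDist s(u, y) v := by
  have h1 := hG.pos_dist_of_ne huv
  have h2 := hG.pos_dist_of_ne hyv
  rw [edgeVertexDist_mk, edgeVertexDist_mk, dist_self]
  omega

theorem Connected.one_le_edgeCount [Fintype G.edgeSet] (hG : G.Connected) {u v : V}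
    (huv : G.Adj u v) (hu : ¬ G.IsLeaf u) : 1 ≤ G.edgeCount u v := by
  obtain ⟨y, hy, hyv⟩ : ∃ y, G.Adj u y ∧ y ≠ v := by
    by_contra! h
    exact hu fun a ha b hb => (h a ha).trans (h b hb).symm
  have := card_le_edgeCount (G := G) (u := u) (v := v) (s := {s(u, y)}) (by
    simpa using ⟨hy, by simpa using hG.edgeVertexDist_lt huv.ne hyv⟩)
  simpa using this

theorem IsLeaf.card_le_edgeCount_add_one [Fintype G.edgeSet] (hG : G.Connected) {u v : V}
    (hu : G.IsLeaf u) (huv : G.Adj u v) : G.edgeFinset.card ≤ G.edgeCount v u + 1 := by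
  classical
  have h := card_le_edgeCount (G := G) (u := v) (v := u) (s := G.edgeFinset.erase s(u, v)) (by
    intro f hf
    rw [Finset.mem_erase, mem_edgeFinset] at hf
    refine ⟨hf.2, ?_⟩
    induction f with
    | _ x y =>
    obtain ⟨hne, hxy⟩ := hf
    rw [mem_edgeSet] at hxy
    have hx : x ≠ u := by
      rintro rfl
      exact hne (by rw [hu hxy huv])
    have hy : y ≠ u := by
      rintro rfl
      exact hne (by rw [hu hxy.symm huv, Sym2.eq_swap])
    rw [edgeVertexDist_mk, edgeVertexDist_mk, hu.dist_eq_add_one hG huv hx,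
      hu.dist_eq_add_one hG huv hy]
    omega)
  rw [Finset.card_erase_of_mem (by simpa using huv)] at h
  omega

/-- `n_u(uv) + n_v(uv)` -/
noncomputable def vertexSum [Fintype V] (G : SimpleGraph V) (e : Sym2 V) : ℕ :=
  Sym2.lift ⟨fun u v => G.vertexCount u v + G.vertexCount v u, fun _ _ => add_comm _ _⟩ e

/-- `n_u(uv) m_v(uv) + n_v(uv) m_u(uv)` -/
noncomputable def mixedTerm [Fintype V] (G : SimpleGraph V) [Fintype G.edgeSet] (e : Sym2 V) : ℕ :=
  Sym2.lift ⟨fun u v => G.vertexCount u v * G.edgeCount v u + G.vertexCount v u * G.edgeCount u v,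
    fun _ _ => add_comm _ _⟩ e

/-- `m_u(uv) m_v(uv)` -/
noncomputable def edgeTerm (G : SimpleGraph V) [Fintype G.edgeSet] (e : Sym2 V) : ℕ :=
  Sym2.lift ⟨fun u v => G.edgeCount u v * G.edgeCount v u, fun _ _ => mul_comm _ _⟩ e

@[simp]
theorem vertexSum_mk [Fintype V] (u v : V) :
    G.vertexSum s(u, v) = G.vertexCount u v + G.vertexCount v u := rfl

@[simp]
theorem mixedTerm_mk [Fintype V] [Fintype G.edgeSet] (u v : V) :
    G.mixedTerm s(u, v) =
      G.vertexCount u v * G.edgeCount v u + G.vertexCount v u * G.edgeCount u v := rfl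

@[simp]
theorem edgeTerm_mk [Fintype G.edgeSet] (u v : V) :
    G.edgeTerm s(u, v) = G.edgeCount u v * G.edgeCount v u := rfl

theorem edgeSzeged_eq [Fintype G.edgeSet] :
    G.edgeSzeged = ∑ e ∈ G.edgeFinset, G.edgeTerm e := rfl

theorem edgeVertexSzeged_eq [Fintype V] [Fintype G.edgeSet] :
    G.edgeVertexSzeged = ((∑ e ∈ G.edgeFinset, G.mixedTerm e : ℕ) : ℚ) / 2 := by
  rw [edgeVertexSzeged, Nat.cast_sum, one_div, inv_mul_eq_div]
  congr 1
  refine Finset.sum_congr rfl fun e _ => ?_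
  induction e with
  | _ u v => simp

open Classical in
/-- The leaves among the endpoints of an edge. -/
noncomputable def leavesOf [Fintype V] (G : SimpleGraph V) (e : Sym2 V) : Finset V :=
  Finset.univ.filter fun x => G.IsLeaf x ∧ x ∈ e

-- Double counting: a leaf lies on at most one edge.
open Classical in
theorem sum_card_leavesOf_le [Fintype V] [Fintype G.edgeSet] :
    ∑ e ∈ G.edgeFinset, (G.leavesOf e).card ≤ (Finset.univ.filter G.IsLeaf).card := by
  have h := Finset.sum_card_bipartiteAbove_eq_sum_card_bipartiteBelow
    (s := G.edgeFinset) (t := Finset.univ.filter G.IsLeaf) (fun e x => x ∈ e)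
  have h1 : ∑ e ∈ G.edgeFinset, (G.leavesOf e).card =
      ∑ e ∈ G.edgeFinset,
        (Finset.bipartiteAbove (fun e x => x ∈ e) (Finset.univ.filter G.IsLeaf) e).card := by
    refine Finset.sum_congr rfl fun e _ => ?_
    rw [leavesOf, Finset.bipartiteAbove, Finset.filter_filter]
  rw [h1, h, Finset.card_eq_sum_ones]
  refine Finset.sum_le_sum fun x hx => Finset.card_le_one.2 fun e he f hf => ?_
  simp only [Finset.mem_filter, Finset.mem_univ, true_and, Finset.bipartiteBelow,
    mem_edgeFinset] at hx he hf
  obtain ⟨y, rfl⟩ := he.2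
  obtain ⟨z, rfl⟩ := hf.2
  have hyz : y = z := hx he.1 hf.1
  rw [hyz]

/-- For fixed `w`, every `x ≠ w` has an edge to a neighbour one step closer to `w`. These edges are
distinct, since `x` is the farther endpoint of its edge, and each of them is counted for `w`. -/
theorem Connected.card_mul_pred_le_sum_vertexSum [Fintype V] [Fintype G.edgeSet]
    (hG : G.Connected) :
    Fintype.card V * (Fintype.card V - 1) ≤ ∑ e ∈ G.edgeFinset, G.vertexSum e := by
  classical
  -- The orientation of `e` is free, so `r e w` says that its endpoints are at different distances
  -- from `w`.
  let r : Sym2 V → V → Prop := fun e w => ∃ u v, e = s(u, v) ∧ G.dist u w < G.dist v w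
  have hle : ∀ e ∈ G.edgeFinset, (Finset.bipartiteAbove r Finset.univ e).card ≤ G.vertexSum e := by
    intro e _
    induction e with
    | _ u v =>
    rw [vertexSum_mk, vertexCount, vertexCount]
    refine le_trans (Finset.card_le_card ?_) (Finset.card_union_le _ _)
    intro w hw
    simp only [Finset.bipartiteAbove, Finset.mem_filter, Finset.mem_univ, true_and,
      Finset.mem_union, r] at hw ⊢
    obtain ⟨x, y, hxy, hlt⟩ := hw
    rcases Sym2.eq_iff.1 hxy with ⟨rfl, rfl⟩ | ⟨rfl, rfl⟩
    · exact Or.inl hlt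
    · exact Or.inr hlt
  refine le_trans ?_ (Finset.sum_le_sum hle)
  rw [Finset.sum_card_bipartiteAbove_eq_sum_card_bipartiteBelow, ← smul_eq_mul,
    ← Finset.card_univ, ← Finset.sum_const]
  refine Finset.sum_le_sum fun w _ => ?_
  have hpar : ∀ x, ∃ y, x ≠ w → G.Adj x y ∧ G.dist y w + 1 = G.dist x w := by
    intro x
    by_cases hx : x = w
    · exact ⟨x, fun h => absurd hx h⟩
    · obtain ⟨y, hy⟩ := hG.exists_adj_dist_add_one hx
      exact ⟨y, fun _ => hy⟩
  choose par hpar using hpar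
  rw [← Finset.card_erase_of_mem (Finset.mem_univ w)]
  refine Finset.card_le_card_of_injOn (fun x => s(x, par x)) ?_ ?_
  · intro x hx
    obtain ⟨h1, h2⟩ := hpar x (Finset.ne_of_mem_erase hx)
    simp only [Finset.bipartiteBelow, Finset.coe_filter, Set.mem_ofPred_eq, mem_edgeFinset,
      mem_edgeSet, r]
    exact ⟨h1, par x, x, Sym2.eq_swap, by omega⟩
  · intro x hx y hy hxy
    have hx' := (hpar x (Finset.ne_of_mem_erase hx)).2
    have hy' := (hpar y (Finset.ne_of_mem_erase hy)).2
    rcases Sym2.eq_iff.1 hxy with ⟨h, _⟩ | ⟨h1, h2⟩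
    · exact h
    · rw [← h1] at hy'
      rw [h2] at hx'
      omega

/-- If neither endpoint is a leaf, both edge counts are at least `1`. If `u` is a leaf, then `m_v ≥
m - 1 ≥ N - 1`, while the vertex sum is at most `N`; the leaf pays for the missing unit. -/
theorem Connected.vertexSum_le [Fintype V] [Fintype G.edgeSet] (hG : G.Connected)
    (hm : Fintype.card V ≤ G.edgeFinset.card) {e : Sym2 V} (he : e ∈ G.edgeFinset) :
    G.vertexSum e ≤ G.mixedTerm e + (G.leavesOf e).card := by
  have key : ∀ u v, G.Adj u v → G.IsLeaf u → G.vertexSum s(u, v) ≤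
      G.mixedTerm s(u, v) + (G.leavesOf s(u, v)).card := by
    intro u v huv hu
    have h1 : 1 ≤ (G.leavesOf s(u, v)).card :=
      Finset.card_pos.2 ⟨u, by simp [leavesOf, hu]⟩
    have h2 := hu.card_le_edgeCount_add_one hG huv
    have h3 := vertexCount_add_le_card (G := G) u v
    have h4 := Nat.mul_le_mul_right (G.edgeCount v u) (one_le_vertexCount huv)
    simp only [vertexSum_mk, mixedTerm_mk]
    omega
  induction e with
  | _ u v =>
  have huv : G.Adj u v := by simpa using he
  by_cases hu : G.IsLeaf u
  · exact key u v huv hu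
  by_cases hv : G.IsLeaf v
  · rw [Sym2.eq_swap]
    exact key v u huv.symm hv
  have h1 := Nat.mul_le_mul_left (G.vertexCount u v) (hG.one_le_edgeCount huv.symm hv)
  have h2 := Nat.mul_le_mul_left (G.vertexCount v u) (hG.one_le_edgeCount huv hu)
  simp only [vertexSum_mk, mixedTerm_mk]
  omega

/-- With fewer edges a connected graph would be a tree. -/
theorem Connected.card_le_card_edgeFinset [Fintype V] [Fintype G.edgeSet] (hG : G.Connected)
    (hc : G.cycles.Nonempty) : Fintype.card V ≤ G.edgeFinset.card := by
  have h1 := hG.card_vert_le_card_edgeSet_add_one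
  have h2 : Nat.card G.edgeSet = G.edgeFinset.card := by
    rw [Nat.card_eq_fintype_card, edgeFinset_card]
  rw [Nat.card_eq_fintype_card (α := V), h2] at h1
  by_contra hlt
  have hT : G.IsTree := isTree_iff_connected_and_card.2
    ⟨hG, by rw [h2, Nat.card_eq_fintype_card]; omega⟩
  obtain ⟨_, v, w, hw, _⟩ := hc
  exact hT.isAcyclic w hw

end SimpleGraph

/-! ### Distances through gates and edge counts at a cycle edge -/

namespace SimpleGraph

namespace CycleRetraction

variable {V : Type*} {G : SimpleGraph V} {L : ℕ} (r : CycleRetraction G L)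

/-- Inequalities between nearby indices, such as `j - ε ≠ j + ε`, reduce to small constants being
nonzero in `ZMod L`. -/
theorem natCast_ne_zero {k : ℕ} (hk : 0 < k) (hkL : k < L) : (k : ZMod L) ≠ 0 := fun h =>
  absurd (Nat.le_of_dvd hk ((ZMod.natCast_eq_zero_iff k L).1 h)) (not_le.2 hkL)

theorem c_injective : Function.Injective r.c := fun i j h => by
  rw [← r.γ_c i, h, r.γ_c]

theorem adj_add {ε : ZMod L} (hε : ε = 1 ∨ ε = -1) (i : ZMod L) : G.Adj (r.c i) (r.c (i + ε)) := by
  rcases hε with rfl | rfl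
  · exact r.adj_succ i
  · simpa using (r.adj_succ (i + -1)).symm

theorem eq_add_one_or_of_adj {i j : ZMod L} (h : G.Adj (r.c i) (r.c j)) :
    j = i + 1 ∨ i = j + 1 := by
  rcases r.eq_or_eq_of_adj h with h1 | ⟨k, hk⟩
  · rw [r.γ_c, r.γ_c] at h1
    exact absurd (h1 ▸ h) (G.irrefl)
  · rcases Sym2.eq_iff.1 hk with ⟨h1, h2⟩ | ⟨h1, h2⟩
    · rw [r.c_injective h1, r.c_injective h2]; simp
    · rw [r.c_injective h1, r.c_injective h2]; simp

theorem two_le_dist (hG : G.Connected) {i j : ZMod L} (h0 : i ≠ j) (h1 : j ≠ i + 1)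
    (h2 : i ≠ j + 1) : 2 ≤ G.dist (r.c i) (r.c j) := by
  have h3 := hG.pos_dist_of_ne (r.c_injective.ne h0)
  have h4 : G.dist (r.c i) (r.c j) ≠ 1 := by
    rw [Ne, dist_eq_one_iff_adj]
    intro h
    rcases r.eq_add_one_or_of_adj h with h | h
    · exact h1 h
    · exact h2 h
  omega

/-- A walk can leave a fiber only along a cycle edge, hence only from the gate itself. -/
theorem dist_add_dist_le_length (hG : G.Connected) {x y : V} (p : G.Walk x y)
    {j : ZMod L} (hy : y = r.c j) :
    G.dist x (r.c (r.γ x)) + G.dist (r.c (r.γ x)) (r.c j) ≤ p.length := by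
  induction p with
  | nil => simp [hy, r.γ_c]
  | @cons x z y h p ih =>
    rcases r.eq_or_eq_of_adj h with h1 | ⟨i, hi⟩
    · have h2 := ih hy
      rw [← h1] at h2
      have h3 := hG.dist_le_add_one h (r.c (r.γ x))
      rw [Walk.length_cons]
      omega
    · have hx : x = r.c (r.γ x) := by
        rcases Sym2.eq_iff.1 hi with ⟨h1, h2⟩ | ⟨h1, h2⟩ <;> rw [h1, r.γ_c]
      rw [← hx, dist_self, zero_add, ← hy]
      exact dist_le (Walk.cons h p)

theorem dist_eq (hG : G.Connected) (x : V) (j : ZMod L) :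
    G.dist x (r.c j) = G.dist x (r.c (r.γ x)) + G.dist (r.c (r.γ x)) (r.c j) := by
  obtain ⟨p, hp⟩ := hG.exists_walk_length_eq_dist x (r.c j)
  exact le_antisymm hG.dist_triangle (hp ▸ r.dist_add_dist_le_length hG p rfl)

/-- The edges of the cycle. -/
def cycleEdge (i : ZMod L) : Sym2 V := s(r.c i, r.c (i + 1))

theorem cycleEdge_mem (i : ZMod L) : r.cycleEdge i ∈ G.edgeSet := r.adj_succ i

theorem cycleEdge_injective (hL : 3 ≤ L) : Function.Injective r.cycleEdge := by
  intro i j h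
  rcases Sym2.eq_iff.1 h with ⟨h1, _⟩ | ⟨h1, h2⟩
  · exact r.c_injective h1
  · have h1 := r.c_injective h1
    have h2 := r.c_injective h2
    have h3 : ((2 : ℕ) : ZMod L) ≠ 0 := natCast_ne_zero (by omega) (by omega)
    refine absurd ?_ h3
    push_cast
    linear_combination h2 - h1

theorem exists_cycleEdge_eq {ε : ZMod L} (hε : ε = 1 ∨ ε = -1) (i : ZMod L) :
    ∃ k, s(r.c i, r.c (i + ε)) = r.cycleEdge k := by
  rcases hε with rfl | rfl
  · exact ⟨i, rfl⟩
  · exact ⟨i + -1, by rw [cycleEdge, neg_add_cancel_right, Sym2.eq_swap]⟩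

/-- The sign `ε` treats both ends of a cycle edge at once: the compared neighbour is `j + ε`, and
the edge counted is the other cycle edge at `j`. -/
theorem edge_closer (hG : G.Connected) (hL : 3 ≤ L) {ε : ZMod L} (hε : ε = 1 ∨ ε = -1)
    (j : ZMod L) : s(r.c j, r.c (j - ε)) ∈ G.edgeSet ∧
      G.edgeVertexDist s(r.c j, r.c (j - ε)) (r.c j) <
        G.edgeVertexDist s(r.c j, r.c (j - ε)) (r.c (j + ε)) := by
  have h1 : ((1 : ℕ) : ZMod L) ≠ 0 := natCast_ne_zero (by omega) (by omega)
  have h2 : ((2 : ℕ) : ZMod L) ≠ 0 := natCast_ne_zero (by omega) (by omega)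
  push_cast at h1 h2
  have hε' : -ε = 1 ∨ -ε = -1 := by grind
  refine ⟨?_, hG.edgeVertexDist_lt (r.c_injective.ne ?_) (r.c_injective.ne ?_)⟩
  · rw [sub_eq_add_neg]; exact r.adj_add hε' j
  · grind
  · grind

section Fiber

variable [Fintype G.edgeSet]

open Classical in
/-- The edges both of whose endpoints have gate `i`. -/
noncomputable def fiberEdges (i : ZMod L) : Finset (Sym2 V) :=
  G.edgeFinset.filter fun f => ∀ x ∈ f, r.γ x = i

theorem mem_fiberEdges {i : ZMod L} {f : Sym2 V} :
    f ∈ r.fiberEdges i ↔ f ∈ G.edgeSet ∧ ∀ x ∈ f, r.γ x = i := by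
  simp [fiberEdges]

theorem mk_mem_fiberEdges {i : ZMod L} {x y : V} :
    s(x, y) ∈ r.fiberEdges i ↔ G.Adj x y ∧ r.γ x = i ∧ r.γ y = i := by
  simp [mem_fiberEdges]

theorem cycleEdge_notMem_fiberEdges (hL : 3 ≤ L) (i j : ZMod L) :
    r.cycleEdge i ∉ r.fiberEdges j := by
  rw [cycleEdge, mk_mem_fiberEdges, r.γ_c, r.γ_c]
  rintro ⟨_, rfl, h⟩
  have h3 : ((1 : ℕ) : ZMod L) ≠ 0 := natCast_ne_zero (by omega) (by omega)
  refine absurd ?_ h3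
  push_cast
  linear_combination h

theorem disjoint_fiberEdges {i j : ZMod L} (hij : i ≠ j) :
    Disjoint (r.fiberEdges i) (r.fiberEdges j) := by
  rw [Finset.disjoint_left]
  intro f hi hj
  induction f with
  | _ x y =>
  rw [mk_mem_fiberEdges] at hi hj
  exact hij (hi.2.1.symm.trans hj.2.1)

theorem mem_fiberEdges_or {f : Sym2 V} (hf : f ∈ G.edgeSet) :
    (∃ i, f ∈ r.fiberEdges i) ∨ ∃ i, r.cycleEdge i = f := by
  induction f with
  | _ x y =>
  rcases r.eq_or_eq_of_adj hf with h | ⟨i, hi⟩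
  · exact Or.inl ⟨r.γ x, r.mk_mem_fiberEdges.2 ⟨hf, rfl, h.symm⟩⟩
  · exact Or.inr ⟨i, hi.symm⟩

open Classical in
theorem edgeFinset_eq [NeZero L] : G.edgeFinset =
    Finset.univ.image r.cycleEdge ∪ Finset.univ.biUnion r.fiberEdges := by
  ext f
  rw [mem_edgeFinset, Finset.mem_union, Finset.mem_image, Finset.mem_biUnion]
  constructor
  · intro hf
    rcases r.mem_fiberEdges_or hf with ⟨i, hi⟩ | ⟨i, hi⟩
    · exact Or.inr ⟨i, Finset.mem_univ _, hi⟩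
    · exact Or.inl ⟨i, Finset.mem_univ _, hi⟩
  · rintro (⟨i, _, rfl⟩ | ⟨i, _, hi⟩)
    · exact r.cycleEdge_mem i
    · exact (r.mem_fiberEdges.1 hi).1

theorem sum_edgeFinset [NeZero L] (hL : 3 ≤ L) (F : Sym2 V → ℕ) :
    ∑ e ∈ G.edgeFinset, F e =
      ∑ i, F (r.cycleEdge i) + ∑ i, ∑ e ∈ r.fiberEdges i, F e := by
  classical
  rw [r.edgeFinset_eq, Finset.sum_union, Finset.sum_image (r.cycleEdge_injective hL).injOn,
    Finset.sum_biUnion]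
  · intro i _ j _ hij
    exact r.disjoint_fiberEdges hij
  · rw [Finset.disjoint_left]
    intro f hf hf'
    rw [Finset.mem_image] at hf
    rw [Finset.mem_biUnion] at hf'
    obtain ⟨i, _, rfl⟩ := hf
    obtain ⟨j, _, hj⟩ := hf'
    exact r.cycleEdge_notMem_fiberEdges hL i j hj

theorem card_edgeFinset [NeZero L] (hL : 3 ≤ L) :
    G.edgeFinset.card = L + ∑ i, (r.fiberEdges i).card := by
  have h := r.sum_edgeFinset hL fun _ => 1
  simpa using h

theorem edgeVertexDist_fiber (hG : G.Connected) {i : ZMod L} {f : Sym2 V}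
    (hf : f ∈ r.fiberEdges i) (j : ZMod L) :
    G.edgeVertexDist f (r.c j) =
      G.edgeVertexDist f (r.c i) + G.dist (r.c i) (r.c j) := by
  induction f with
  | _ x y =>
  obtain ⟨_, hx, hy⟩ := r.mk_mem_fiberEdges.1 hf
  rw [edgeVertexDist_mk, edgeVertexDist_mk, r.dist_eq hG x j, r.dist_eq hG y j, hx, hy]
  omega

theorem fiber_closer (hG : G.Connected) {i j k : ZMod L} {f : Sym2 V} (hf : f ∈ r.fiberEdges i)
    (h : G.dist (r.c i) (r.c j) < G.dist (r.c i) (r.c k)) :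
    f ∈ G.edgeSet ∧ G.edgeVertexDist f (r.c j) < G.edgeVertexDist f (r.c k) := by
  refine ⟨(r.mem_fiberEdges.1 hf).1, ?_⟩
  rw [r.edgeVertexDist_fiber hG hf j, r.edgeVertexDist_fiber hG hf k]
  omega

theorem fiber_closer_self (hG : G.Connected) {j k : ZMod L} {f : Sym2 V}
    (hf : f ∈ r.fiberEdges j) (h : j ≠ k) :
    f ∈ G.edgeSet ∧ G.edgeVertexDist f (r.c j) < G.edgeVertexDist f (r.c k) :=
  r.fiber_closer hG hf (by rw [dist_self]; exact hG.pos_dist_of_ne (r.c_injective.ne h))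

theorem one_add_card_le (hG : G.Connected) (hL : 3 ≤ L) {ε : ZMod L} (hε : ε = 1 ∨ ε = -1)
    (j : ZMod L) : 1 + (r.fiberEdges j).card ≤ G.edgeCount (r.c j) (r.c (j + ε)) := by
  classical
  have h1 : ((1 : ℕ) : ZMod L) ≠ 0 := natCast_ne_zero (by omega) (by omega)
  push_cast at h1
  obtain ⟨k, hk⟩ := r.exists_cycleEdge_eq (ε := -ε) (by grind) j
  rw [← sub_eq_add_neg] at hk
  have h := card_le_edgeCount (G := G) (u := r.c j) (v := r.c (j + ε))
    (s := insert s(r.c j, r.c (j - ε)) (r.fiberEdges j)) (by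
      intro f hf
      rcases Finset.mem_insert.1 hf with rfl | hf
      · exact r.edge_closer hG hL hε j
      · exact r.fiber_closer_self hG hf (by grind))
  rw [Finset.card_insert_of_notMem (hk ▸ r.cycleEdge_notMem_fiberEdges hL k j)] at h
  omega

/-- From length `4` on, `c (j - ε)` is at distance at least `2` from `c (j + ε)`, so its whole fiber
is closer to `c j`. -/
theorem one_add_card_add_card_le (hG : G.Connected) (hL : 4 ≤ L) {ε : ZMod L}
    (hε : ε = 1 ∨ ε = -1) (j : ZMod L) :
    1 + (r.fiberEdges j).card + (r.fiberEdges (j - ε)).card ≤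
      G.edgeCount (r.c j) (r.c (j + ε)) := by
  classical
  have h1 : ((1 : ℕ) : ZMod L) ≠ 0 := natCast_ne_zero (by omega) (by omega)
  have h2 : ((2 : ℕ) : ZMod L) ≠ 0 := natCast_ne_zero (by omega) (by omega)
  have h3 : ((3 : ℕ) : ZMod L) ≠ 0 := natCast_ne_zero (by omega) (by omega)
  push_cast at h1 h2 h3
  obtain ⟨k, hk⟩ := r.exists_cycleEdge_eq (ε := -ε) (by grind) j
  rw [← sub_eq_add_neg] at hk
  have hd : G.dist (r.c (j - ε)) (r.c j) = 1 := by
    rw [dist_eq_one_iff_adj]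
    simpa using r.adj_add hε (j - ε)
  have hd2 : 2 ≤ G.dist (r.c (j - ε)) (r.c (j + ε)) :=
    r.two_le_dist hG (by grind) (by grind) (by grind)
  have h := card_le_edgeCount (G := G) (u := r.c j) (v := r.c (j + ε))
    (s := insert s(r.c j, r.c (j - ε)) (r.fiberEdges j ∪ r.fiberEdges (j - ε))) (by
      intro f hf
      rcases Finset.mem_insert.1 hf with rfl | hf
      · exact r.edge_closer hG (by omega) hε j
      rcases Finset.mem_union.1 hf with hf | hf
      · exact r.fiber_closer_self hG hf (by grind)
      · exact r.fiber_closer hG hf (by omega))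
  rw [Finset.card_insert_of_notMem, Finset.card_union_of_disjoint] at h
  · omega
  · exact r.disjoint_fiberEdges (by grind)
  · rw [hk, Finset.mem_union, not_or]
    exact ⟨r.cycleEdge_notMem_fiberEdges (by omega) _ _,
      r.cycleEdge_notMem_fiberEdges (by omega) _ _⟩

/-- From length `5` on, `c (j - ε - ε)` is not adjacent to `c (j + ε)` either, so a second cycle
edge is closer to `c j`. -/
theorem two_add_card_le (hG : G.Connected) (hL : 5 ≤ L) {ε : ZMod L} (hε : ε = 1 ∨ ε = -1)
    (j : ZMod L) : 2 + (r.fiberEdges j).card ≤ G.edgeCount (r.c j) (r.c (j + ε)) := by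
  classical
  have h1 : ((1 : ℕ) : ZMod L) ≠ 0 := natCast_ne_zero (by omega) (by omega)
  have h2 : ((2 : ℕ) : ZMod L) ≠ 0 := natCast_ne_zero (by omega) (by omega)
  have h3 : ((3 : ℕ) : ZMod L) ≠ 0 := natCast_ne_zero (by omega) (by omega)
  have h4 : ((4 : ℕ) : ZMod L) ≠ 0 := natCast_ne_zero (by omega) (by omega)
  push_cast at h1 h2 h3 h4
  have hε' : -ε = 1 ∨ -ε = -1 := by grind
  obtain ⟨k, hk⟩ := r.exists_cycleEdge_eq hε' j
  obtain ⟨k', hk'⟩ := r.exists_cycleEdge_eq hε' (j - ε)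
  have hadj := r.adj_add hε' (j - ε)
  rw [← sub_eq_add_neg] at hk hk' hadj
  have hd : G.dist (r.c (j - ε)) (r.c j) = 1 := by
    rw [dist_eq_one_iff_adj]
    simpa using r.adj_add hε (j - ε)
  have hd2 : 2 ≤ G.dist (r.c (j - ε)) (r.c (j + ε)) :=
    r.two_le_dist hG (by grind) (by grind) (by grind)
  have hd3 : 2 ≤ G.dist (r.c (j - ε - ε)) (r.c (j + ε)) :=
    r.two_le_dist hG (by grind) (by grind) (by grind)
  have h := card_le_edgeCount (G := G) (u := r.c j) (v := r.c (j + ε))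
    (s := insert s(r.c j, r.c (j - ε)) (insert s(r.c (j - ε), r.c (j - ε - ε))
      (r.fiberEdges j))) (by
      intro f hf
      rcases Finset.mem_insert.1 hf with rfl | hf
      · exact r.edge_closer hG (by omega) hε j
      rcases Finset.mem_insert.1 hf with rfl | hf
      · refine ⟨hadj, ?_⟩
        rw [edgeVertexDist_mk, edgeVertexDist_mk]
        omega
      · exact r.fiber_closer_self hG hf (by grind))
  rw [Finset.card_insert_of_notMem, Finset.card_insert_of_notMem] at h
  · omega
  · exact hk' ▸ r.cycleEdge_notMem_fiberEdges (by omega) k' j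
  · rw [Finset.mem_insert, not_or]
    refine ⟨fun h => ?_, hk ▸ r.cycleEdge_notMem_fiberEdges (by omega) k j⟩
    rcases Sym2.eq_iff.1 h with ⟨h, _⟩ | ⟨h, _⟩ <;> have := r.c_injective h <;> grind

end Fiber

end CycleRetraction

end SimpleGraph

/-! ### Lower bounds according to the length of the cycle -/

namespace SimpleGraph

namespace CycleRetraction

variable {V : Type*} {G : SimpleGraph V} {L : ℕ} (r : CycleRetraction G L)

theorem not_isLeaf (hL : 3 ≤ L) (i : ZMod L) : ¬ G.IsLeaf (r.c i) := by
  intro h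
  have h2 : ((2 : ℕ) : ZMod L) ≠ 0 := natCast_ne_zero (by omega) (by omega)
  push_cast at h2
  have h3 := r.c_injective (h (r.adj_add (Or.inl rfl) i) (r.adj_add (Or.inr rfl) i))
  exact h2 (by linear_combination h3)

open Classical in
theorem sum_card_fiber [Fintype V] [NeZero L] :
    ∑ i, (Finset.univ.filter fun x => r.γ x = i).card = Fintype.card V :=
  (Finset.card_eq_sum_card_fiberwise fun x _ => Finset.mem_univ (r.γ x)).symm

open Classical in
theorem card_fiber_le_vertexCount [Fintype V] (hG : G.Connected) {j k : ZMod L} (h : j ≠ k) :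
    (Finset.univ.filter fun x => r.γ x = j).card ≤ G.vertexCount (r.c j) (r.c k) := by
  refine Finset.card_le_card fun x hx => ?_
  rw [Finset.mem_filter] at hx ⊢
  obtain ⟨_, rfl⟩ := hx
  have h1 := r.dist_eq hG x k
  have h2 := hG.pos_dist_of_ne (r.c_injective.ne h)
  rw [dist_comm (v := x), dist_comm (v := x)]
  exact ⟨Finset.mem_univ _, by omega⟩

theorem two_le_vertexCount [Fintype V] (hG : G.Connected) (hL : 4 ≤ L) {ε : ZMod L}
    (hε : ε = 1 ∨ ε = -1) (j : ZMod L) : 2 ≤ G.vertexCount (r.c j) (r.c (j + ε)) := by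
  classical
  have h1 : ((1 : ℕ) : ZMod L) ≠ 0 := natCast_ne_zero (by omega) (by omega)
  have h2 : ((2 : ℕ) : ZMod L) ≠ 0 := natCast_ne_zero (by omega) (by omega)
  have h3 : ((3 : ℕ) : ZMod L) ≠ 0 := natCast_ne_zero (by omega) (by omega)
  push_cast at h1 h2 h3
  have hd : G.dist (r.c j) (r.c (j - ε)) = 1 := by
    rw [dist_comm, dist_eq_one_iff_adj]
    simpa using r.adj_add hε (j - ε)
  have hd2 : 2 ≤ G.dist (r.c (j + ε)) (r.c (j - ε)) :=
    r.two_le_dist hG (by grind) (by grind) (by grind)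
  have hd3 : G.dist (r.c (j + ε)) (r.c j) = 1 := by
    rw [dist_comm, dist_eq_one_iff_adj]
    exact r.adj_add hε j
  rw [← Finset.card_pair (r.c_injective.ne (show j ≠ j - ε by grind))]
  refine Finset.card_le_card fun x hx => ?_
  rw [Finset.mem_filter]
  refine ⟨Finset.mem_univ _, ?_⟩
  rw [Finset.mem_insert, Finset.mem_singleton] at hx
  rcases hx with rfl | rfl
  · rw [dist_self]; omega
  · omega

open Classical in
theorem card_leaves_add_le (r : CycleRetraction G L) [Fintype V] [NeZero L] (hL : 3 ≤ L) :
    (Finset.univ.filter G.IsLeaf).card + L ≤ Fintype.card V := by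
  have h : (Finset.univ.image r.c).card = L := by
    rw [Finset.card_image_of_injective _ r.c_injective, Finset.card_univ, ZMod.card]
  have h' : ((Finset.univ.filter G.IsLeaf) ∪ (Finset.univ.image r.c)).card ≤ Fintype.card V :=
    Finset.card_le_univ _
  rw [Finset.card_union_of_disjoint, h] at h'
  · exact h'
  · rw [Finset.disjoint_left]
    intro x hx hx'
    obtain ⟨i, _, rfl⟩ := Finset.mem_image.1 hx'
    exact r.not_isLeaf hL i (Finset.mem_filter.1 hx).2

theorem vertexSum_cycleEdge [Fintype V] (i : ZMod L) : G.vertexSum (r.cycleEdge i) =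
    G.vertexCount (r.c i) (r.c (i + 1)) + G.vertexCount (r.c (i + 1)) (r.c i) := rfl

variable [Fintype G.edgeSet]

theorem one_add_card_le_right (hG : G.Connected) (hL : 3 ≤ L) (i : ZMod L) :
    1 + (r.fiberEdges (i + 1)).card ≤ G.edgeCount (r.c (i + 1)) (r.c i) := by
  simpa using r.one_add_card_le hG hL (Or.inr rfl) (i + 1)

theorem one_add_card_add_card_le_right (hG : G.Connected) (hL : 4 ≤ L) (i : ZMod L) :
    1 + (r.fiberEdges (i + 1)).card + (r.fiberEdges (i + 2)).card ≤
      G.edgeCount (r.c (i + 1)) (r.c i) := by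
  have h := r.one_add_card_add_card_le hG hL (Or.inr rfl) (i + 1)
  rw [show i + 1 - -1 = i + 2 by ring, show i + 1 + -1 = i by ring] at h
  exact h

theorem two_add_card_le_right (hG : G.Connected) (hL : 5 ≤ L) (i : ZMod L) :
    2 + (r.fiberEdges (i + 1)).card ≤ G.edgeCount (r.c (i + 1)) (r.c i) := by
  simpa using r.two_add_card_le hG hL (Or.inr rfl) (i + 1)

theorem edgeTerm_cycleEdge (i : ZMod L) : G.edgeTerm (r.cycleEdge i) =
    G.edgeCount (r.c i) (r.c (i + 1)) * G.edgeCount (r.c (i + 1)) (r.c i) := rfl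

theorem sum_shift [NeZero L] (F : ZMod L → ℕ) (k : ZMod L) : ∑ i, F (i + k) = ∑ i, F i :=
  Fintype.sum_equiv (Equiv.addRight k) _ _ fun _ => rfl

theorem le_edgeSzeged_of_five_le (r : CycleRetraction G L) (hG : G.Connected) (hL : 5 ≤ L) :
    4 * G.edgeFinset.card ≤ G.edgeSzeged := by
  have : NeZero L := ⟨by omega⟩
  rw [edgeSzeged_eq, r.sum_edgeFinset (by omega), r.card_edgeFinset (by omega)]
  refine le_trans ?_ (Nat.le_add_right _ _)
  have h : ∀ i, 4 + 2 * (r.fiberEdges i).card + 2 * (r.fiberEdges (i + 1)).card ≤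
      G.edgeTerm (r.cycleEdge i) := by
    intro i
    rw [edgeTerm_cycleEdge]
    refine le_trans ?_ (Nat.mul_le_mul (r.two_add_card_le hG hL (Or.inl rfl) i)
      (r.two_add_card_le_right hG hL i))
    nlinarith [Nat.zero_le ((r.fiberEdges i).card * (r.fiberEdges (i + 1)).card)]
  refine le_trans (le_of_eq ?_) (Finset.sum_le_sum fun i _ => h i)
  rw [Finset.sum_add_distrib, Finset.sum_add_distrib, ← Finset.mul_sum, ← Finset.mul_sum,
    sum_shift (fun i => (r.fiberEdges i).card)]
  simp
  ring

theorem le_edgeSzeged_of_four (r : CycleRetraction G 4) (hG : G.Connected) :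
    4 * G.edgeFinset.card ≤ G.edgeSzeged + 12 := by
  rw [edgeSzeged_eq, r.sum_edgeFinset (by omega), r.card_edgeFinset (by omega)]
  have h : ∀ i, 1 + (r.fiberEdges i).card + (r.fiberEdges (i - 1)).card +
      (r.fiberEdges (i + 1)).card + (r.fiberEdges (i + 2)).card ≤
      G.edgeTerm (r.cycleEdge i) := by
    intro i
    rw [edgeTerm_cycleEdge]
    refine le_trans ?_ (Nat.mul_le_mul (r.one_add_card_add_card_le hG le_rfl (Or.inl rfl) i)
      (r.one_add_card_add_card_le_right hG le_rfl i))
    nlinarith [Nat.zero_le (((r.fiberEdges i).card + (r.fiberEdges (i - 1)).card) *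
      ((r.fiberEdges (i + 1)).card + (r.fiberEdges (i + 2)).card))]
  have h' := Finset.sum_le_sum (s := Finset.univ) fun i _ => h i
  rw [Finset.sum_add_distrib, Finset.sum_add_distrib, Finset.sum_add_distrib,
    Finset.sum_add_distrib, sum_shift (fun i => (r.fiberEdges i).card),
    sum_shift (fun i => (r.fiberEdges i).card)] at h'
  have h'' := sum_shift (fun i => (r.fiberEdges i).card) (-1)
  simp only [← sub_eq_add_neg] at h''
  rw [h''] at h'
  simp only [Finset.sum_const, Finset.card_univ, ZMod.card, smul_eq_mul] at h'
  omega

/-- The products of fiber sizes and the terms off the triangle are kept because both must vanish in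
the equality case. -/
theorem le_edgeSzeged_of_three (r : CycleRetraction G 3) (hG : G.Connected) :
    2 * G.edgeFinset.card + ∑ i, (r.fiberEdges i).card * (r.fiberEdges (i + 1)).card
      + ∑ i, ∑ e ∈ r.fiberEdges i, G.edgeTerm e ≤ G.edgeSzeged + 3 := by
  rw [edgeSzeged_eq, r.sum_edgeFinset le_rfl, r.card_edgeFinset le_rfl]
  have h : ∀ i, 1 + (r.fiberEdges i).card + (r.fiberEdges (i + 1)).card +
      (r.fiberEdges i).card * (r.fiberEdges (i + 1)).card ≤ G.edgeTerm (r.cycleEdge i) := by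
    intro i
    rw [edgeTerm_cycleEdge]
    refine le_trans (le_of_eq ?_) (Nat.mul_le_mul (r.one_add_card_le hG le_rfl (Or.inl rfl) i)
      (r.one_add_card_le_right hG le_rfl i))
    ring
  have h' := Finset.sum_le_sum (s := Finset.univ) fun i _ => h i
  rw [Finset.sum_add_distrib, Finset.sum_add_distrib, Finset.sum_add_distrib,
    sum_shift (fun i => (r.fiberEdges i).card)] at h'
  simp only [Finset.sum_const, Finset.card_univ, ZMod.card, smul_eq_mul] at h'
  omega

section Mixed

variable [Fintype V]

-- Here `x i` is the surplus of the mixed term over the vertex sum at the cycle edge `i`; all other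
-- edges are handled by `vertexSum_le`.
open Classical in
theorem le_sum_mixedTerm [NeZero L] (hL : 3 ≤ L) (hG : G.Connected)
    (hm : Fintype.card V ≤ G.edgeFinset.card) (x : ZMod L → ℕ)
    (hx : ∀ i, G.vertexSum (r.cycleEdge i) + x i ≤ G.mixedTerm (r.cycleEdge i)) :
    Fintype.card V * (Fintype.card V - 1) + ∑ i, x i ≤
      ∑ e ∈ G.edgeFinset, G.mixedTerm e + (Finset.univ.filter G.IsLeaf).card := by
  have h1 := hG.card_mul_pred_le_sum_vertexSum
  have h2 := G.sum_card_leavesOf_le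
  rw [r.sum_edgeFinset hL] at h1 h2
  rw [r.sum_edgeFinset hL]
  have h3 := Finset.sum_le_sum (s := Finset.univ) fun i _ => hx i
  rw [Finset.sum_add_distrib] at h3
  have h4 : ∑ i, ∑ e ∈ r.fiberEdges i, G.vertexSum e ≤
      ∑ i, ∑ e ∈ r.fiberEdges i, (G.mixedTerm e + (G.leavesOf e).card) :=
    Finset.sum_le_sum fun i _ => Finset.sum_le_sum fun e he =>
      hG.vertexSum_le hm (mem_edgeFinset.2 (r.mem_fiberEdges.1 he).1)
  simp only [Finset.sum_add_distrib] at h4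
  omega

theorem mixedTerm_cycleEdge (i : ZMod L) : G.mixedTerm (r.cycleEdge i) =
    G.vertexCount (r.c i) (r.c (i + 1)) * G.edgeCount (r.c (i + 1)) (r.c i) +
    G.vertexCount (r.c (i + 1)) (r.c i) * G.edgeCount (r.c i) (r.c (i + 1)) := rfl

theorem lt_sum_mixedTerm_of_five_le (r : CycleRetraction G L) (hG : G.Connected) (hL : 5 ≤ L)
    (hm : Fintype.card V ≤ G.edgeFinset.card) :
    Fintype.card V ^ 2 < ∑ e ∈ G.edgeFinset, G.mixedTerm e := by
  classical
  have : NeZero L := ⟨by omega⟩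
  have h1 : ((1 : ℕ) : ZMod L) ≠ 0 := natCast_ne_zero (by omega) (by omega)
  push_cast at h1
  have h := r.le_sum_mixedTerm (by omega) hG hm (fun i => G.vertexSum (r.cycleEdge i)) (by
    intro i
    rw [vertexSum_cycleEdge, mixedTerm_cycleEdge]
    have h1 := Nat.mul_le_mul_left (G.vertexCount (r.c (i + 1)) (r.c i))
      (le_trans (Nat.le_add_right 2 _) (r.two_add_card_le hG hL (Or.inl rfl) i))
    have h2 := Nat.mul_le_mul_left (G.vertexCount (r.c i) (r.c (i + 1)))
      (le_trans (Nat.le_add_right 2 _) (r.two_add_card_le_right hG hL i))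
    omega)
  -- Each end of a cycle edge is the closer one for its whole fiber, and each fiber is met at two
  -- cycle edges.
  have h2 : 2 * Fintype.card V ≤ ∑ i, G.vertexSum (r.cycleEdge i) := by
    have h3 := Finset.sum_le_sum (s := Finset.univ) fun i _ => add_le_add
      (r.card_fiber_le_vertexCount hG (j := i) (k := i + 1) fun h => h1 (by linear_combination -h))
      (r.card_fiber_le_vertexCount hG (j := i + 1) (k := i) fun h => h1 (by linear_combination h))
    rw [Finset.sum_add_distrib, r.sum_card_fiber,
      sum_shift (fun i => (Finset.univ.filter fun x => r.γ x = i).card), r.sum_card_fiber] at h3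
    simp only [vertexSum_cycleEdge]
    omega
  have h3 := r.card_leaves_add_le (by omega)
  obtain ⟨n, hn⟩ : ∃ n, Fintype.card V = n + 1 := ⟨Fintype.card V - 1, by omega⟩
  rw [hn] at h h2 h3 ⊢
  simp only [Nat.add_sub_cancel] at h
  nlinarith

theorem lt_sum_mixedTerm_of_four (r : CycleRetraction G 4) (hG : G.Connected)
    (hn : 5 ≤ Fintype.card V) (hm : Fintype.card V ≤ G.edgeFinset.card) :
    Fintype.card V ^ 2 < ∑ e ∈ G.edgeFinset, G.mixedTerm e + 3 := by
  classical
  have h := r.le_sum_mixedTerm (by omega) hG hm (fun i => 2 * ((r.fiberEdges i).card +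
      (r.fiberEdges (i - 1)).card + (r.fiberEdges (i + 1)).card + (r.fiberEdges (i + 2)).card)) (by
    intro i
    rw [vertexSum_cycleEdge, mixedTerm_cycleEdge]
    have h1 := r.one_add_card_add_card_le hG le_rfl (Or.inl rfl) i
    have h2 := r.one_add_card_add_card_le_right hG le_rfl i
    have h3 := r.two_le_vertexCount hG le_rfl (Or.inl rfl) i
    have h4 := r.two_le_vertexCount hG le_rfl (Or.inr rfl) (i + 1)
    rw [add_neg_cancel_right] at h4
    nlinarith)
  have h1 := r.card_leaves_add_le (by omega)
  have h2 := r.card_edgeFinset (by omega)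
  rw [← Finset.mul_sum, Finset.sum_add_distrib, Finset.sum_add_distrib, Finset.sum_add_distrib,
    sum_shift (fun i => (r.fiberEdges i).card), sum_shift (fun i => (r.fiberEdges i).card)] at h
  have h'' := sum_shift (fun i => (r.fiberEdges i).card) (-1)
  simp only [← sub_eq_add_neg] at h''
  rw [h''] at h
  obtain ⟨n, hn'⟩ : ∃ n, Fintype.card V = n + 1 := ⟨Fintype.card V - 1, by omega⟩
  rw [hn'] at h h1 hm hn ⊢
  simp only [Nat.add_sub_cancel] at h
  -- With `N` vertices and `m ≥ N`: `N(N - 1) + 8(m - 4) - (N - 4) ≥ N² + 6N - 28`, which exceeds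
  -- `N² - 3` for `N ≥ 5`.
  nlinarith

open Classical in
theorem le_sum_mixedTerm_of_three (r : CycleRetraction G 3) (hG : G.Connected)
    (hm : Fintype.card V ≤ G.edgeFinset.card) :
    Fintype.card V * (Fintype.card V - 1) +
      ∑ i, (G.vertexCount (r.c i) (r.c (i + 1)) * (r.fiberEdges (i + 1)).card +
        G.vertexCount (r.c (i + 1)) (r.c i) * (r.fiberEdges i).card) ≤
      ∑ e ∈ G.edgeFinset, G.mixedTerm e + (Finset.univ.filter G.IsLeaf).card := by
  refine r.le_sum_mixedTerm le_rfl hG hm _ fun i => ?_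
  rw [vertexSum_cycleEdge, mixedTerm_cycleEdge]
  have h1 := Nat.mul_le_mul_left (G.vertexCount (r.c (i + 1)) (r.c i))
    (r.one_add_card_le hG le_rfl (Or.inl rfl) i)
  have h2 := Nat.mul_le_mul_left (G.vertexCount (r.c i) (r.c (i + 1)))
    (r.one_add_card_le_right hG le_rfl i)
  rw [mul_add, mul_one] at h1 h2
  omega

theorem two_mul_sum_le_of_three (r : CycleRetraction G 3) :
    2 * ∑ i, (r.fiberEdges i).card ≤
      ∑ i, (G.vertexCount (r.c i) (r.c (i + 1)) * (r.fiberEdges (i + 1)).card +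
        G.vertexCount (r.c (i + 1)) (r.c i) * (r.fiberEdges i).card) := by
  have h := Finset.sum_le_sum (s := Finset.univ) fun i _ => add_le_add
    (Nat.mul_le_mul_right (r.fiberEdges (i + 1)).card (one_le_vertexCount (r.adj_succ i)))
    (Nat.mul_le_mul_right (r.fiberEdges i).card (one_le_vertexCount (r.adj_succ i).symm))
  refine le_trans (le_of_eq ?_) h
  simp only [one_mul]
  rw [Finset.sum_add_distrib, sum_shift (fun i => (r.fiberEdges i).card)]
  ring

end Mixed

end CycleRetraction

end SimpleGraph

/-! ### The equality case: a triangle with pendant edges at one vertex -/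

namespace SimpleGraph

variable {V : Type*} {G : SimpleGraph V}

/-- A triangle `z`, `a`, `b` with pendant edges attached at `z`. -/
structure IsTriangleStar (G : SimpleGraph V) (z a b : V) : Prop where
  adj_center : ∀ x, x ≠ z → G.Adj z x
  adj_base : G.Adj a b
  ne_left : a ≠ z
  ne_right : b ≠ z
  eq_of_adj : ∀ {x y}, G.Adj x y → x = z ∨ y = z ∨ s(x, y) = s(a, b)

namespace CycleRetraction

theorem isTriangleStar_of_three [Fintype V] [Fintype G.edgeSet] (r : CycleRetraction G 3)
    (hG : G.Connected) (hn : 3 < Fintype.card V)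
    (hfib : ∀ i, (r.fiberEdges i).card = 0 ∨ (r.fiberEdges (i + 1)).card = 0)
    (hleaf : ∀ x y i, s(x, y) ∈ r.fiberEdges i → G.IsLeaf x ∨ G.IsLeaf y) :
    ∃ z a b, G.IsTriangleStar z a b := by
  have hfiber : ∀ {w y}, w ≠ r.c (r.γ w) → G.Adj w y → s(w, y) ∈ r.fiberEdges (r.γ w) := by
    intro w y hw hwy
    rw [mk_mem_fiberEdges]
    rcases r.eq_or_eq_of_adj hwy with h | ⟨i, hi⟩
    · exact ⟨hwy, rfl, h.symm⟩
    · refine absurd ?_ hw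
      rcases Sym2.eq_iff.1 hi with ⟨h, _⟩ | ⟨h, _⟩ <;> rw [h, r.γ_c]
  -- Otherwise take two steps `w`, `y`, `x` towards the gate: `y` has the neighbours `w` and `x`,
  -- and `x` is the gate or has a further neighbour closer to it, so the edge `yx` has no leaf.
  have hgate : ∀ w, w ≠ r.c (r.γ w) → G.Adj w (r.c (r.γ w)) := by
    intro w hw
    obtain ⟨y, hwy, hyd⟩ := hG.exists_adj_dist_add_one hw
    by_cases hy : y = r.c (r.γ w)
    · exact hy ▸ hwy
    exfalso
    have hγy : r.γ y = r.γ w := (r.mk_mem_fiberEdges.1 (hfiber hw hwy)).2.2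
    rw [← hγy] at hy hyd
    obtain ⟨x, hyx, hxd⟩ := hG.exists_adj_dist_add_one hy
    have hyl : ¬ G.IsLeaf y := fun h => by
      have hwx : w = x := h hwy.symm hyx
      rw [hwx] at hyd
      omega
    have hxl : ¬ G.IsLeaf x := by
      by_cases hx : x = r.c (r.γ y)
      · rw [hx]; exact r.not_isLeaf le_rfl _
      · obtain ⟨t, hxt, htd⟩ := hG.exists_adj_dist_add_one hx
        intro h
        have hyt : y = t := h hyx.symm hxt
        rw [hyt] at hxd
        rw [hyt] at htd
        omega
    rcases hleaf _ _ _ (hfiber hy hyx) with h | h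
    · exact hyl h
    · exact hxl h
  have hpos : ∀ w, w ≠ r.c (r.γ w) → (r.fiberEdges (r.γ w)).card ≠ 0 := fun w hw =>
    (Finset.card_pos.2 ⟨_, hfiber hw (hgate w hw)⟩).ne'
  obtain ⟨w₀, hw₀⟩ : ∃ w, w ≠ r.c (r.γ w) := by
    by_contra! h
    have hinj : Function.Injective r.γ := fun x y hxy => by rw [h x, h y, hxy]
    have := Fintype.card_le_of_injective _ hinj
    rw [ZMod.card] at this
    omega
  -- Any two distinct indices are consecutive on a triangle, so `hfib` leaves only one fiber with
  -- edges.
  have hcases : ∀ i j : ZMod 3, j = i ∨ j = i + 1 ∨ i = j + 1 := by decide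
  have hγ : ∀ w, w ≠ r.c (r.γ w) → r.γ w = r.γ w₀ := by
    intro w hw
    rcases hcases (r.γ w₀) (r.γ w) with h | h | h
    · exact h
    · have := hfib (r.γ w₀)
      rw [← h] at this
      exact absurd this (not_or.2 ⟨hpos _ hw₀, hpos _ hw⟩)
    · have := hfib (r.γ w)
      rw [← h] at this
      exact absurd this (not_or.2 ⟨hpos _ hw, hpos _ hw₀⟩)
  set i := r.γ w₀ with hi
  have hcenter : ∀ x y k, s(x, y) ∈ r.fiberEdges k → G.IsLeaf x → y = r.c i := by
    intro x y k hxy hx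
    have hxc : x ≠ r.c (r.γ x) := fun h => r.not_isLeaf le_rfl (r.γ x) (h ▸ hx)
    rw [← hγ x hxc]
    exact hx (r.mk_mem_fiberEdges.1 hxy).1 (hgate x hxc)
  refine ⟨r.c i, r.c (i + 1), r.c (i + 1 + 1), ?_, r.adj_succ _, ?_, ?_, ?_⟩
  · intro x hx
    by_cases hxc : x = r.c (r.γ x)
    · rw [hxc] at hx ⊢
      rcases hcases i (r.γ x) with h | h | h
      · exact absurd (by rw [h]) hx
      · rw [h]; exact r.adj_succ i
      · rw [h]; exact (r.adj_succ _).symm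
    · rw [← hγ x hxc]
      exact (hgate x hxc).symm
  · exact (r.adj_succ i).ne'
  · refine r.c_injective.ne ?_
    generalize i = j
    revert j
    decide
  · intro x y hxy
    rcases r.mem_fiberEdges_or (f := s(x, y)) hxy with ⟨k, hk⟩ | ⟨k, hk⟩
    · rcases hleaf _ _ _ hk with h | h
      · exact Or.inr (Or.inl (hcenter x y k hk h))
      · exact Or.inl (hcenter y x k (by rwa [Sym2.eq_swap]) h)
    · rw [cycleEdge] at hk
      rcases hcases i k with rfl | rfl | h
      · rcases Sym2.eq_iff.1 hk with ⟨h, _⟩ | ⟨h, _⟩ <;> simp [← h]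
      · exact Or.inr (Or.inr hk.symm)
      · rw [← h] at hk
        rcases Sym2.eq_iff.1 hk with ⟨_, h⟩ | ⟨_, h⟩ <;> simp [← h]

theorem exists_isTriangleStar_of_edgeSzeged_le [Fintype V] [Fintype G.edgeSet]
    (r : CycleRetraction G 3) (hG : G.Connected) (hn : 3 < Fintype.card V)
    (hm : Fintype.card V ≤ G.edgeFinset.card) (h : G.edgeSzeged + 3 ≤ 2 * Fintype.card V) :
    ∃ z a b, G.IsTriangleStar z a b := by
  have h1 := r.le_edgeSzeged_of_three hG
  have h2 : ∑ i, (r.fiberEdges i).card * (r.fiberEdges (i + 1)).card = 0 := by omega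
  have h3 : ∑ i, ∑ e ∈ r.fiberEdges i, G.edgeTerm e = 0 := by omega
  refine r.isTriangleStar_of_three hG hn (fun i => ?_) fun x y i hxy => ?_
  · rw [Finset.sum_eq_zero_iff] at h2
    exact Nat.mul_eq_zero.1 (h2 i (Finset.mem_univ _))
  · rw [Finset.sum_eq_zero_iff] at h3
    have h4 := Finset.sum_eq_zero_iff.1 (h3 i (Finset.mem_univ _)) _ hxy
    have hadj := (r.mk_mem_fiberEdges.1 hxy).1
    rw [edgeTerm_mk, Nat.mul_eq_zero] at h4
    by_contra! hcon
    have h5 := hG.one_le_edgeCount hadj hcon.1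
    have h6 := hG.one_le_edgeCount hadj.symm hcon.2
    omega

theorem le_sum_mixedTerm_add_three [Fintype V] [Fintype G.edgeSet]
    (r : CycleRetraction G 3) (hG : G.Connected) (hm : Fintype.card V ≤ G.edgeFinset.card) :
    Fintype.card V ^ 2 ≤ ∑ e ∈ G.edgeFinset, G.mixedTerm e + 3 := by
  classical
  have h1 := r.le_sum_mixedTerm_of_three hG hm
  have h2 := r.two_mul_sum_le_of_three
  have h3 := r.card_edgeFinset le_rfl
  have h4 := r.card_leaves_add_le le_rfl
  have h5 : Fintype.card V ^ 2 = Fintype.card V * (Fintype.card V - 1) + Fintype.card V := by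
    rw [← Nat.mul_succ, Nat.succ_eq_add_one, Nat.sub_add_cancel (by omega), sq]
  omega

/-- Two consecutive fibers with edges make the surplus on the triangle strictly larger; a fiber edge
without a leaf gives a non-leaf off the triangle, so there are at most `N - 4` leaves. Either way
the bound becomes strict. -/
theorem exists_isTriangleStar_of_mixedTerm_le [Fintype V] [Fintype G.edgeSet]
    (r : CycleRetraction G 3) (hG : G.Connected) (hn : 3 < Fintype.card V)
    (hm : Fintype.card V ≤ G.edgeFinset.card)
    (h : ∑ e ∈ G.edgeFinset, G.mixedTerm e + 3 ≤ Fintype.card V ^ 2) :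
    ∃ z a b, G.IsTriangleStar z a b := by
  classical
  have h1 := r.le_sum_mixedTerm_of_three hG hm
  have h2 := r.two_mul_sum_le_of_three
  have h3 := r.card_edgeFinset le_rfl
  have h4 := r.card_leaves_add_le le_rfl
  have h5 : Fintype.card V ^ 2 = Fintype.card V * (Fintype.card V - 1) + Fintype.card V := by
    rw [← Nat.mul_succ, Nat.succ_eq_add_one, Nat.sub_add_cancel (by omega), sq]
  refine r.isTriangleStar_of_three hG hn (fun i => ?_) fun x y i hxy => ?_
  · by_contra! hcon
    have hlt : 2 * ∑ i, (r.fiberEdges i).card <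
        ∑ i, (G.vertexCount (r.c i) (r.c (i + 1)) * (r.fiberEdges (i + 1)).card +
        G.vertexCount (r.c (i + 1)) (r.c i) * (r.fiberEdges i).card) := by
      have hs : 2 * ∑ i, (r.fiberEdges i).card =
          ∑ i, ((r.fiberEdges (i + 1)).card + (r.fiberEdges i).card) := by
        rw [Finset.sum_add_distrib, sum_shift (fun i => (r.fiberEdges i).card)]
        ring
      rw [hs]
      refine Finset.sum_lt_sum (fun j _ => add_le_add
        (Nat.le_mul_of_pos_left _ (one_le_vertexCount (r.adj_succ j)))
        (Nat.le_mul_of_pos_left _ (one_le_vertexCount (r.adj_succ j).symm)))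
        ⟨i, Finset.mem_univ _, add_lt_add_of_lt_of_le ?_
        (Nat.le_mul_of_pos_left _ (one_le_vertexCount (r.adj_succ i).symm))⟩
      have h6 : 2 ≤ G.vertexCount (r.c i) (r.c (i + 1)) := by
        refine le_trans ?_ (r.card_fiber_le_vertexCount hG (k := i + 1)
          fun h => (r.adj_succ i).ne (congrArg r.c h))
        obtain ⟨f, hf⟩ := Finset.card_pos.1 (Nat.pos_of_ne_zero hcon.1)
        induction f with
        | _ x y =>
        obtain ⟨hadj, hx, hy⟩ := r.mk_mem_fiberEdges.1 hf
        rw [← Finset.card_pair hadj.ne]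
        refine Finset.card_le_card fun t ht => ?_
        rw [Finset.mem_insert, Finset.mem_singleton] at ht
        rw [Finset.mem_filter]
        rcases ht with rfl | rfl
        · exact ⟨Finset.mem_univ _, hx⟩
        · exact ⟨Finset.mem_univ _, hy⟩
      have h7 := Nat.mul_le_mul_right (r.fiberEdges (i + 1)).card h6
      omega
    omega
  · by_contra! hcon
    obtain ⟨hadj, hx, hy⟩ := r.mk_mem_fiberEdges.1 hxy
    obtain ⟨t, ht, htl⟩ : ∃ t, t ∉ Finset.univ.image r.c ∧ ¬ G.IsLeaf t := by
      by_cases hxc : x ∈ Finset.univ.image r.c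
      · refine ⟨y, fun hyc => ?_, hcon.2⟩
        obtain ⟨j, _, rfl⟩ := Finset.mem_image.1 hxc
        obtain ⟨k, _, rfl⟩ := Finset.mem_image.1 hyc
        rw [r.γ_c] at hx hy
        rw [hx, hy] at hadj
        exact G.irrefl hadj
      · exact ⟨x, hxc, hcon.1⟩
    have hc : (Finset.univ.image r.c).card = 3 := by
      rw [Finset.card_image_of_injective _ r.c_injective, Finset.card_univ, ZMod.card]
    have hle : (Finset.univ.filter G.IsLeaf).card + 1 + 3 ≤ Fintype.card V := by
      have h' : (insert t (Finset.univ.filter G.IsLeaf) ∪ (Finset.univ.image r.c)).card ≤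
        Fintype.card V := Finset.card_le_univ _
      rw [Finset.card_union_of_disjoint, hc, Finset.card_insert_of_notMem] at h'
      · exact h'
      · simpa using htl
      · rw [Finset.disjoint_left]
        intro x hx hx'
        rcases Finset.mem_insert.1 hx with rfl | hx
        · exact ht hx'
        obtain ⟨i, _, rfl⟩ := Finset.mem_image.1 hx'
        exact r.not_isLeaf le_rfl i (Finset.mem_filter.1 hx).2
    omega

end CycleRetraction

end SimpleGraph

/-! ### Triangle stars: isomorphism with `triangleBundle n 1` and upper bounds -/

namespace SimpleGraph

variable {V : Type*} {G : SimpleGraph V}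

theorem triangleBundle_one_adj {n : ℕ} {i j : Fin n} : (triangleBundle n 1).Adj i j ↔
    i ≠ j ∧ (i.val = 0 ∨ j.val = 0 ∨ (i.val = 1 ∧ j.val = 2) ∨ (i.val = 2 ∧ j.val = 1)) := by
  simp only [triangleBundle, fromRel_adj, Nat.lt_one_iff, exists_eq_left, mul_zero, zero_add]
  tauto

theorem isTriangleStar_of_iso {n : ℕ} (hn : 3 ≤ n) (e : G ≃g triangleBundle n 1) :
    G.IsTriangleStar (e.symm ⟨0, by omega⟩) (e.symm ⟨1, by omega⟩) (e.symm ⟨2, by omega⟩) where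
  adj_center x hx := by
    rw [← e.map_adj_iff, e.apply_symm_apply, triangleBundle_one_adj]
    exact ⟨fun h => hx (by rw [h, e.symm_apply_apply]), by simp⟩
  adj_base := by
    rw [e.symm.map_adj_iff, triangleBundle_one_adj]
    simp
  ne_left := e.symm.injective.ne (by simp)
  ne_right := e.symm.injective.ne (by simp)
  eq_of_adj {x y} hxy := by
    rw [← e.map_adj_iff, triangleBundle_one_adj] at hxy
    have key : ∀ (t : V) (k : ℕ) (hk : k < n), (e t).val = k → t = e.symm ⟨k, hk⟩ := by
      rintro t _ hk rfl
      simp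
    rcases hxy.2 with h | h | ⟨h, h'⟩ | ⟨h, h'⟩
    · exact Or.inl (key _ _ _ h)
    · exact Or.inr (Or.inl (key _ _ _ h))
    · exact Or.inr (Or.inr (by rw [key _ _ (by omega) h, key _ _ (by omega) h']))
    · exact Or.inr (Or.inr (by rw [key _ _ (by omega) h, key _ _ (by omega) h', Sym2.eq_swap]))

namespace IsTriangleStar

variable {z a b : V}

theorem swap (h : G.IsTriangleStar z a b) : G.IsTriangleStar z b a :=
  ⟨h.adj_center, h.adj_base.symm, h.ne_right, h.ne_left, fun hxy => by
    rw [Sym2.eq_swap (a := b)]; exact h.eq_of_adj hxy⟩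

theorem adj_iff (h : G.IsTriangleStar z a b) {x y : V} :
    G.Adj x y ↔ x ≠ y ∧ (x = z ∨ y = z ∨ (x = a ∧ y = b) ∨ (x = b ∧ y = a)) := by
  constructor
  · intro hxy
    refine ⟨hxy.ne, ?_⟩
    rw [← Sym2.eq_iff]
    exact h.eq_of_adj hxy
  · rintro ⟨hne, rfl | rfl | ⟨rfl, rfl⟩ | ⟨rfl, rfl⟩⟩
    · exact h.adj_center _ hne.symm
    · exact (h.adj_center _ hne).symm
    · exact h.adj_base
    · exact h.adj_base.symm

theorem nonempty_iso [Fintype V] (h : G.IsTriangleStar z a b) {n : ℕ}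
    (hn : Fintype.card V = n) (h3 : 3 ≤ n) : Nonempty (G ≃g triangleBundle n 1) := by
  classical
  have hab := h.adj_base.ne
  have haz := h.ne_left
  have hbz := h.ne_right
  -- Only the values at `z`, `a`, `b` matter; any bijection extending them preserves adjacency.
  let f : V → Fin n := fun x => if x = z then ⟨0, by omega⟩ else
    if x = a then ⟨1, by omega⟩ else ⟨2, by omega⟩
  have hfz : f z = ⟨0, by omega⟩ := by simp [f]
  have hfa : f a = ⟨1, by omega⟩ := by simp [f, haz]
  have hfb : f b = ⟨2, by omega⟩ := by simp [f, hbz, hab.symm]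
  obtain ⟨g, hg⟩ := Finset.exists_equiv_extend_of_card_eq (α := V)
    (t := (Finset.univ : Finset (Fin n))) (by simpa using hn) (s := {z, a, b}) (f := f)
    (Finset.subset_univ _) (by
      intro x hx y hy hxy
      simp only [Finset.coe_insert, Finset.coe_singleton, Set.mem_insert_iff,
        Set.mem_singleton_iff] at hx hy
      rcases hx with rfl | rfl | rfl <;> rcases hy with rfl | rfl | rfl <;>
        simp_all)
  let e : V ≃ Fin n := g.trans (Equiv.subtypeUnivEquiv Finset.mem_univ)
  have he : ∀ x, e x = (g x : Fin n) := fun x => rfl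
  have hez : e z = ⟨0, by omega⟩ := by rw [he, hg z (by simp), hfz]
  have hea : e a = ⟨1, by omega⟩ := by rw [he, hg a (by simp), hfa]
  have heb : e b = ⟨2, by omega⟩ := by rw [he, hg b (by simp), hfb]
  refine ⟨⟨e, fun {x y} => ?_⟩⟩
  rw [triangleBundle_one_adj, h.adj_iff]
  have key : ∀ (t u : V) (k : ℕ) (hk : k < n), e u = ⟨k, hk⟩ → ((e t).val = k ↔ t = u) := by
    intro t u k hk hu
    rw [← e.injective.eq_iff, hu, Fin.ext_iff]
  rw [key x z 0 _ hez, key y z 0 _ hez, key x a 1 _ hea, key y a 1 _ hea, key x b 2 _ heb,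
    key y b 2 _ heb, e.injective.ne_iff]

theorem dist_center_le (h : G.IsTriangleStar z a b) (x : V) : G.dist z x ≤ 1 := by
  by_cases hx : x = z
  · simp [hx]
  · exact (dist_eq_one_iff_adj.2 (h.adj_center x hx)).le

theorem dist_le_two (h : G.IsTriangleStar z a b) (hG : G.Connected) (x y : V) :
    G.dist x y ≤ 2 := by
  have h1 := hG.dist_triangle (u := x) (v := z) (w := y)
  have h2 := h.dist_center_le x
  have h3 := h.dist_center_le y
  rw [dist_comm] at h2
  omega

/-- Every edge but `ab` contains `z`, and `ab` is at distance at most `1` from `z`, so it must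
contain `x`. -/
theorem eq_of_closer (h : G.IsTriangleStar z a b) (hG : G.Connected) {x : V} {f : Sym2 V}
    (hf : f ∈ G.edgeSet) (hlt : G.edgeVertexDist f x < G.edgeVertexDist f z) :
    f = s(a, b) ∧ (x = a ∨ x = b) := by
  induction f with
  | _ p q =>
  rw [edgeVertexDist_mk, edgeVertexDist_mk] at hlt
  have h1 := h.dist_center_le p
  rw [dist_comm] at h1
  have h2 : s(p, q) = s(a, b) := by
    rcases h.eq_of_adj hf with rfl | rfl | h2
    · rw [dist_self] at hlt; omega
    · rw [dist_self] at hlt; omega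
    · exact h2
  refine ⟨h2, ?_⟩
  have h3 : x = p ∨ x = q := by
    by_contra! hne
    have := hG.pos_dist_of_ne hne.1.symm
    have := hG.pos_dist_of_ne hne.2.symm
    omega
  have h4 : x ∈ s(a, b) := by rw [← h2, Sym2.mem_iff]; exact h3
  exact Sym2.mem_iff.1 h4

theorem card_sdiff [Fintype V] [DecidableEq V] (h : G.IsTriangleStar z a b) :
    (Finset.univ \ {z, a, b} : Finset V).card + 3 = Fintype.card V := by
  have h3 : ({z, a, b} : Finset V).card = 3 :=
    Finset.card_eq_three.2 ⟨z, a, b, h.ne_left.symm, h.ne_right.symm, h.adj_base.ne, rfl⟩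
  rw [← h3, Finset.card_sdiff_add_card_eq_card (Finset.subset_univ _), Finset.card_univ]

section Vertex

variable [Fintype V]

theorem vertexCount_center_le (h : G.IsTriangleStar z a b) (hG : G.Connected) (x : V) :
    G.vertexCount x z ≤ 1 := by
  rw [← Finset.card_singleton x]
  refine Finset.card_le_card fun w hw => ?_
  have h1 := (Finset.mem_filter.1 hw).2
  have h2 := h.dist_center_le w
  exact Finset.mem_singleton.2 (hG.dist_eq_zero_iff.1 (by omega)).symm

/-- Distances are at most `2`, so a vertex other than `a` that is closer to `a` would be a neighbour
of `a`, that is `z` or `b`; neither qualifies. -/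
theorem vertexCount_base_le (h : G.IsTriangleStar z a b) (hG : G.Connected) :
    G.vertexCount a b ≤ 1 := by
  rw [← Finset.card_singleton a]
  refine Finset.card_le_card fun w hw => ?_
  have h1 := (Finset.mem_filter.1 hw).2
  have h2 := h.dist_le_two hG b w
  rw [Finset.mem_singleton]
  by_contra hne
  have h3 := hG.pos_dist_of_ne (Ne.symm hne)
  have h4 : G.Adj a w := dist_eq_one_iff_adj.1 (by omega)
  rcases (h.adj_iff.1 h4).2 with h5 | rfl | ⟨_, rfl⟩ | ⟨h5, _⟩
  · exact h.ne_left h5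
  · have := h.dist_center_le b
    rw [dist_comm] at this
    omega
  · simp at h1
  · exact h.adj_base.ne h5

theorem vertexCount_center_left_le (h : G.IsTriangleStar z a b) :
    G.vertexCount z a + 2 ≤ Fintype.card V := by
  classical
  have h1 : (Finset.univ.filter fun w : V => G.dist z w < G.dist a w) ⊆
      Finset.univ \ {a, b} := by
    intro w hw
    have h1 := (Finset.mem_filter.1 hw).2
    rw [Finset.mem_sdiff, Finset.mem_insert, Finset.mem_singleton]
    refine ⟨Finset.mem_univ _, ?_⟩
    rintro (rfl | rfl)
    · simp at h1
    · rw [dist_eq_one_iff_adj.2 h.adj_base,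
        dist_eq_one_iff_adj.2 (h.adj_center _ h.ne_right)] at h1
      omega
  have h2 := Finset.card_le_card h1
  rw [Finset.card_sdiff_of_subset (Finset.subset_univ _), Finset.card_pair h.adj_base.ne,
    Finset.card_univ] at h2
  have h3 : 2 ≤ Fintype.card V := by
    rw [← Finset.card_pair h.adj_base.ne]
    exact Finset.card_le_univ _
  rw [vertexCount]
  omega

end Vertex

section Edge

variable [Fintype G.edgeSet]

theorem edgeCount_add_card_le {u v : V} {s : Finset (Sym2 V)} (hs : ∀ f ∈ s, f ∈ G.edgeSet)
    (hs' : ∀ f ∈ s, G.edgeVertexDist f v ≤ G.edgeVertexDist f u) :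
    G.edgeCount u v + s.card ≤ G.edgeFinset.card := by
  classical
  rw [edgeCount, ← Finset.card_union_of_disjoint]
  · refine Finset.card_le_card (Finset.union_subset (Finset.filter_subset _ _) fun f hf => ?_)
    exact mem_edgeFinset.2 (hs f hf)
  · rw [Finset.disjoint_left]
    intro f hf hf'
    exact absurd (Finset.mem_filter.1 hf).2 (not_lt.2 (hs' f hf'))

theorem edgeCount_center_le (h : G.IsTriangleStar z a b) (hG : G.Connected) (x : V) :
    G.edgeCount x z ≤ 1 := by
  rw [← Finset.card_singleton s(a, b)]
  refine Finset.card_le_card fun f hf => ?_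
  rw [Finset.mem_filter, mem_edgeFinset] at hf
  exact Finset.mem_singleton.2 (h.eq_of_closer hG hf.1 hf.2).1

theorem edgeCount_center_eq_zero (h : G.IsTriangleStar z a b) (hG : G.Connected) {x : V}
    (ha : x ≠ a) (hb : x ≠ b) : G.edgeCount x z = 0 := by
  rw [edgeCount, Finset.card_eq_zero, Finset.filter_eq_empty_iff]
  intro f hf hlt
  rcases (h.eq_of_closer hG (mem_edgeFinset.1 hf) hlt).2 with h1 | h1
  · exact ha h1
  · exact hb h1

theorem edgeCount_base_le (h : G.IsTriangleStar z a b) (hG : G.Connected) :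
    G.edgeCount a b ≤ 1 := by
  rw [← Finset.card_singleton s(z, a)]
  refine Finset.card_le_card fun f hf => ?_
  rw [Finset.mem_filter, mem_edgeFinset] at hf
  obtain ⟨hf, hlt⟩ := hf
  rw [Finset.mem_singleton]
  have key : ∀ q, G.edgeVertexDist s(z, q) a < G.edgeVertexDist s(z, q) b → q = a := by
    intro q hlt
    rw [edgeVertexDist_mk, edgeVertexDist_mk] at hlt
    have h1 := h.dist_center_le b
    have h2 := hG.pos_dist_of_ne h.ne_left.symm
    exact hG.dist_eq_zero_iff.1 (by omega)
  induction f with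
  | _ p q =>
  rcases h.eq_of_adj hf with rfl | rfl | h2
  · rw [key q hlt]
  · rw [Sym2.eq_swap] at hlt ⊢
    rw [key p hlt]
  · rw [h2, edgeVertexDist_mk, edgeVertexDist_mk, dist_self, dist_self] at hlt
    omega

theorem edgeCount_center_add_one_le (h : G.IsTriangleStar z a b) {x : V} (hx : x ≠ z) :
    G.edgeCount z x + 1 ≤ G.edgeFinset.card := by
  rw [← Finset.card_singleton s(z, x)]
  refine edgeCount_add_card_le ?_ ?_
  · simpa using h.adj_center x hx
  · simp

theorem edgeCount_center_left_le (h : G.IsTriangleStar z a b) :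
    G.edgeCount z a + 2 ≤ G.edgeFinset.card := by
  classical
  have hne : s(z, a) ≠ s(a, b) := fun h1 => by
    rcases Sym2.eq_iff.1 h1 with ⟨h1, _⟩ | ⟨h1, _⟩
    · exact h.ne_left h1.symm
    · exact h.ne_right h1.symm
  rw [← Finset.card_pair hne]
  refine edgeCount_add_card_le ?_ ?_
  · simpa using ⟨h.adj_center a h.ne_left, h.adj_base⟩
  · simp

theorem sum_edgeFinset [Fintype V] [DecidableEq V] (h : G.IsTriangleStar z a b)
    (F : Sym2 V → ℕ) : ∑ e ∈ G.edgeFinset, F e =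
      F s(a, b) + F s(z, a) + F s(z, b) + ∑ x ∈ Finset.univ \ {z, a, b}, F s(z, x) := by
  have hE : G.edgeFinset = insert s(a, b) ((Finset.univ.erase z).image fun x => s(z, x)) := by
    ext f
    induction f with
    | _ x y =>
    rw [mem_edgeFinset, mem_edgeSet, Finset.mem_insert, Finset.mem_image]
    constructor
    · intro hxy
      rcases h.eq_of_adj hxy with rfl | rfl | h2
      · exact Or.inr ⟨y, by simpa using hxy.ne', rfl⟩
      · exact Or.inr ⟨x, by simpa using hxy.ne, Sym2.eq_swap⟩
      · exact Or.inl h2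
    · rintro (h1 | ⟨t, ht, h1⟩)
      · rw [← mem_edgeSet, h1]; exact h.adj_base
      · rw [← mem_edgeSet, ← h1]; exact h.adj_center t (Finset.ne_of_mem_erase ht)
  have h1 : (Finset.univ.erase z : Finset V) =
      insert a (insert b (Finset.univ \ {z, a, b})) := by
    ext t
    have := h.ne_left
    have := h.ne_right
    simp only [Finset.mem_erase, Finset.mem_insert, Finset.mem_sdiff, Finset.mem_univ,
      Finset.mem_singleton]
    grind
  rw [hE, Finset.sum_insert, Finset.sum_image, h1, Finset.sum_insert, Finset.sum_insert]
  · ring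
  · simp
  · simp [h.adj_base.ne]
  · intro x _ y _ hxy
    exact Sym2.congr_right.1 hxy
  · rw [Finset.mem_image]
    rintro ⟨t, _, ht⟩
    rcases Sym2.eq_iff.1 ht with ⟨h1, _⟩ | ⟨h1, _⟩
    · exact h.ne_left h1.symm
    · exact h.ne_right h1.symm

theorem card_edgeFinset [Fintype V] (h : G.IsTriangleStar z a b) :
    G.edgeFinset.card = Fintype.card V := by
  classical
  have h1 := h.sum_edgeFinset fun _ => 1
  simp only [Finset.sum_const, smul_eq_mul, mul_one] at h1
  have := h.card_sdiff
  omega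

theorem edgeSzeged_le [Fintype V] (h : G.IsTriangleStar z a b) (hG : G.Connected) :
    G.edgeSzeged + 3 ≤ 2 * Fintype.card V := by
  classical
  rw [edgeSzeged_eq, h.sum_edgeFinset, Finset.sum_eq_zero]
  · simp only [edgeTerm_mk]
    have h1 := Nat.mul_le_mul (h.edgeCount_base_le hG) (h.swap.edgeCount_base_le hG)
    have h2 := Nat.mul_le_mul_left (G.edgeCount z a) (h.edgeCount_center_le hG a)
    have h3 := Nat.mul_le_mul_left (G.edgeCount z b) (h.edgeCount_center_le hG b)
    have h4 := h.edgeCount_center_left_le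
    have h5 := h.swap.edgeCount_center_left_le
    rw [h.card_edgeFinset] at h4 h5
    -- The base contributes at most `1`, each of the two legs at most `N - 2`, and the pendant edges
    -- nothing.
    omega
  · intro x hx
    simp only [Finset.mem_sdiff, Finset.mem_univ, Finset.mem_insert, Finset.mem_singleton,
      true_and, not_or] at hx
    rw [edgeTerm_mk, h.edgeCount_center_eq_zero hG hx.2.1 hx.2.2, mul_zero]

theorem sum_mixedTerm_le [Fintype V] (h : G.IsTriangleStar z a b) (hG : G.Connected) :
    ∑ e ∈ G.edgeFinset, G.mixedTerm e + 3 ≤ Fintype.card V ^ 2 := by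
  classical
  have hm := h.card_edgeFinset
  have hs : ∑ x ∈ Finset.univ \ {z, a, b}, G.mixedTerm s(z, x) ≤
      (Finset.univ \ {z, a, b} : Finset V).card * (Fintype.card V - 1) := by
    rw [← smul_eq_mul, ← Finset.sum_const]
    refine Finset.sum_le_sum fun x hx => ?_
    simp only [Finset.mem_sdiff, Finset.mem_univ, Finset.mem_insert, Finset.mem_singleton,
      true_and, not_or] at hx
    rw [mixedTerm_mk, h.edgeCount_center_eq_zero hG hx.2.1 hx.2.2, mul_zero, zero_add]
    have h1 := Nat.mul_le_mul_right (G.edgeCount z x) (h.vertexCount_center_le hG x)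
    have h2 := h.edgeCount_center_add_one_le hx.1
    omega
  have key : ∀ a b, G.IsTriangleStar z a b → G.mixedTerm s(z, a) + 4 ≤ 2 * Fintype.card V := by
    intro a b h
    rw [mixedTerm_mk]
    have h1 := Nat.mul_le_mul_left (G.vertexCount z a) (h.edgeCount_center_le hG a)
    have h2 := Nat.mul_le_mul_right (G.edgeCount z a) (h.vertexCount_center_le hG a)
    have h3 := h.vertexCount_center_left_le
    have h4 := h.edgeCount_center_left_le
    omega
  have h1 := key a b h
  have h2 := key b a h.swap
  have h3 : G.mixedTerm s(a, b) ≤ 2 := by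
    rw [mixedTerm_mk]
    have h3 := Nat.mul_le_mul (h.vertexCount_base_le hG) (h.swap.edgeCount_base_le hG)
    have h4 := Nat.mul_le_mul (h.swap.vertexCount_base_le hG) (h.edgeCount_base_le hG)
    omega
  rw [h.sum_edgeFinset]
  have h4 := h.card_sdiff
  generalize (Finset.univ \ {z, a, b} : Finset V).card = k at hs h4
  rw [← h4] at hs h1 h2 ⊢
  rw [show k + 3 - 1 = k + 2 by omega] at hs
  -- With `N = k + 3`: `2 + 2(2N - 4) + (N - 3)(N - 1) = N² - 3`, from the base, the two legs and
  -- the pendant edges.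
  nlinarith

end Edge

end IsTriangleStar

end SimpleGraph

/-! ### Assembly of the two inequalities and their equality cases -/

theorem corollary1p2 {V : Type*} [Fintype V] (G : SimpleGraph V) [Fintype G.edgeSet]
    (n k : ℕ) (hn : 5 ≤ n) (hk : k ≠ 0) (hcard : Fintype.card V = n)
    (hG : G.IsCactus) (hcycles : G.cycles.ncard = k) :
    (2 * (n : ℚ) - 3 ≤ (G.edgeSzeged : ℚ) ∧
      ((n : ℚ) ^ 2 - 3) / 2 ≤ G.edgeVertexSzeged) ∧
    ((G.edgeSzeged : ℚ) = 2 * (n : ℚ) - 3 ↔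
      Nonempty (G ≃g SimpleGraph.triangleBundle n 1)) ∧
    (G.edgeVertexSzeged = ((n : ℚ) ^ 2 - 3) / 2 ↔
      Nonempty (G ≃g SimpleGraph.triangleBundle n 1)) := by
  classical
  have hne : G.cycles.Nonempty := Set.nonempty_of_ncard_ne_zero (by omega)
  have hconn := hG.1
  have hm := hconn.card_le_card_edgeFinset hne
  obtain ⟨L, hL, ⟨r⟩⟩ := hG.exists_cycleRetraction hne
  subst hcard
  have hedge : 2 * Fintype.card V ≤ G.edgeSzeged + 3 ∧
      (G.edgeSzeged + 3 ≤ 2 * Fintype.card V → ∃ z a b, G.IsTriangleStar z a b) := by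
    obtain rfl | rfl | h5 : L = 3 ∨ L = 4 ∨ 5 ≤ L := by omega
    · have h := r.le_edgeSzeged_of_three hconn
      exact ⟨by omega, r.exists_isTriangleStar_of_edgeSzeged_le hconn (by omega) hm⟩
    · have h := r.le_edgeSzeged_of_four hconn
      exact ⟨by omega, fun h' => by omega⟩
    · have h := r.le_edgeSzeged_of_five_le hconn h5
      exact ⟨by omega, fun h' => by omega⟩
  have hmixed : Fintype.card V ^ 2 ≤ ∑ e ∈ G.edgeFinset, G.mixedTerm e + 3 ∧
      (∑ e ∈ G.edgeFinset, G.mixedTerm e + 3 ≤ Fintype.card V ^ 2 →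
        ∃ z a b, G.IsTriangleStar z a b) := by
    obtain rfl | rfl | h5 : L = 3 ∨ L = 4 ∨ 5 ≤ L := by omega
    · exact ⟨r.le_sum_mixedTerm_add_three hconn hm,
        r.exists_isTriangleStar_of_mixedTerm_le hconn (by omega) hm⟩
    · have h := r.lt_sum_mixedTerm_of_four hconn hn hm
      exact ⟨by omega, fun h' => by omega⟩
    · have h := r.lt_sum_mixedTerm_of_five_le hconn h5 hm
      exact ⟨by omega, fun h' => by omega⟩
  have hedgeQ : 2 * (Fintype.card V : ℚ) ≤ G.edgeSzeged + 3 := by exact_mod_cast hedge.1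
  have hmixedQ : (Fintype.card V : ℚ) ^ 2 ≤
      ((∑ e ∈ G.edgeFinset, G.mixedTerm e : ℕ) : ℚ) + 3 := by exact_mod_cast hmixed.1
  have hiso : (∃ z a b, G.IsTriangleStar z a b) →
      Nonempty (G ≃g SimpleGraph.triangleBundle (Fintype.card V) 1) := by
    rintro ⟨z, a, b, h⟩
    exact h.nonempty_iso rfl (by omega)
  rw [SimpleGraph.edgeVertexSzeged_eq]
  refine ⟨⟨by linarith, by linarith⟩, ⟨fun h => hiso (hedge.2 ?_), ?_⟩,
    ⟨fun h => hiso (hmixed.2 ?_), ?_⟩⟩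
  · have h' : (G.edgeSzeged : ℚ) + 3 ≤ 2 * (Fintype.card V : ℚ) := by linarith
    exact_mod_cast h'
  · rintro ⟨e⟩
    have h := (SimpleGraph.isTriangleStar_of_iso (by omega) e).edgeSzeged_le hconn
    have h' : (G.edgeSzeged : ℚ) + 3 ≤ 2 * (Fintype.card V : ℚ) := by exact_mod_cast h
    linarith
  · have h' : ((∑ e ∈ G.edgeFinset, G.mixedTerm e : ℕ) : ℚ) + 3 ≤ (Fintype.card V : ℚ) ^ 2 := by
      linarith
    exact_mod_cast h'
  · rintro ⟨e⟩
    have h := (SimpleGraph.isTriangleStar_of_iso (by omega) e).sum_mixedTerm_le hconn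
    have h' : ((∑ e ∈ G.edgeFinset, G.mixedTerm e : ℕ) : ℚ) + 3 ≤ (Fintype.card V : ℚ) ^ 2 := by
      exact_mod_cast h
    linarith
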